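/- Let $d\ge 2$ be an integer and let $\gamma>d$ be real. Let $\mu_d$ be the measure on the space $\mathcal L^d$ of unsensed lines of $\mathbb R^d$ that is invariant under Euclidean isometries, normalized so that the set of lines hitting a compact convex set $K$ with non-empty interior has measure $\tfrac12 m_{d-1}(\partial K)$, where $m_{d-1}$ is $(d-1)$-dimensional Hausdorff measure. Let $\Pi$ be a Poisson point process on $\mathcal L^d\times(0,\infty)$ with intensity measure $(\gamma-1)v^{-\gamma}\,dv\,\mu_d(d\ell)$; a point $(\ell,v)$ of $\Pi$ is a line $\ell$ with speed-limit $v$. For $v>0$ put $\mathcal S_v=\bigcup\{\ell : (\ell,w)\in\Pi,\ w\ge v\}$. For $0<T<\infty$, a $\Pi$-path with terminal time $T$ is a locally Lipschitz map $\xi:[0,T)\to\mathbb R^d$ such that, for every $v>0$, the set $\{t\in[0,T) : |\xi'(t)|>v \text{ and } \xi(t)\notin\mathcal S_v\}$ is Lebesgue-null. It connects $x_1$ to $x_2$ if $\xi(0)=x_1$ and $\xi$ extends continuously to $[0,T]$ with $\xi(T)=x_2$. It is a $\Pi$-geodesic (minimum-time $\Pi$-path) from $x_1$ to $x_2$ if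 it connects $x_1$ to $x_2$ and no $\Pi$-path with terminal time $S<T$ connects $x_1$ to $x_2$. Then, for any two fixed distinct points $x_1,x_2\in\mathbb R^d$, almost surely there exists a $\Pi$-geodesic from $x_1$ to $x_2$. -/

import Mathlib

open MeasureTheory ProbabilityTheory Set Filter Topology
open scoped ENNReal NNReal

noncomputable section

namespace PoissonRoads

/-- Euclidean space `ℝ^d`. -/
abbrev E (d : ℕ) : Type := EuclideanSpace ℝ (Fin d)

/-! ### Lines and the invariant measure on lines -/

/-- The space of all (unsensed) lines of `ℝ^d`: the one-dimensional affine subspaces. -/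
def Line (d : ℕ) : Type :=
  {l : AffineSubspace ℝ (E d) // (l : Set (E d)).Nonempty ∧ Module.finrank ℝ l.direction = 1}

/-- The set of points of a line. -/
def Line.points {d : ℕ} (l : Line d) : Set (E d) := (l.1 : Set (E d))

/-- The line through the point `x` with direction the unit vector `e`. -/
def lineThrough {d : ℕ} (e : Metric.sphere (0 : E d) 1) (x : E d) : Line d :=
  ⟨AffineSubspace.mk' x (ℝ ∙ (e : E d)), ⟨x, AffineSubspace.self_mem_mk' _ _⟩, by
    rw [AffineSubspace.direction_mk']
    refine finrank_span_singleton ?_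
    intro h
    have := e.2
    simp [h] at this⟩

/-- The Borel structure of line-space: line-space is a quotient of (unit directions) × (points)
and carries the quotient `σ`-algebra. -/
instance Line.instMeasurableSpace (d : ℕ) : MeasurableSpace (Line d) :=
  MeasurableSpace.map (fun p : Metric.sphere (0 : E d) 1 × E d => lineThrough p.1 p.2) inferInstance

/-- Pairs `(e, x)` with `x` in the slab `0 ≤ ⟨e, x⟩ < 1` of unit thickness orthogonal to `e`. -/
def slab (d : ℕ) : Set (Metric.sphere (0 : E d) 1 × E d) :=
  {p | inner ℝ (p.1 : E d) p.2 ∈ Ico (0 : ℝ) 1}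

/-- The invariant measure `μ_d` on the lines of `ℝ^d`, normalized so that the lines hitting a
flat piece of hypersurface have mass equal to its area.

With `κ` the volume of the unit ball of `ℝ^(d-1)`, it is `1 / (2 κ)` times the integral over all
unit vectors `e` (surface measure; the factor `2` since `e` and `-e` give the same lines) of
`(d-1)`-dimensional Lebesgue measure on the hyperplane orthogonal to `e`, whose point `y` stands
for the line through `y` in direction `e`. The Lebesgue measure on the hyperplane is written as
the image of the `d`-dimensional one on a slab of unit thickness; `lineMeasure_apply` below states
the disintegration itself. -/
def lineMeasure (d : ℕ) : Measure (Line d) :=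
  (2 * volume (Metric.ball (0 : E (d - 1)) 1))⁻¹ •
    ((((volume : Measure (E d)).toSphere.prod volume).restrict (slab d)).map
      fun p => lineThrough p.1 p.2)

theorem measurable_lineThrough (d : ℕ) :
    Measurable fun p : Metric.sphere (0 : E d) 1 × E d => lineThrough p.1 p.2 :=
  fun _ h => h

theorem measurableSet_slab (d : ℕ) : MeasurableSet (slab d) := by
  unfold slab
  refine measurableSet_Ico.preimage (Continuous.measurable ?_)
  fun_prop

theorem lineThrough_eq {d : ℕ} (e : Metric.sphere (0 : E d) 1) {x y : E d}
    (h : x - y ∈ (ℝ ∙ (e : E d))) : lineThrough e x = lineThrough e y := by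
  apply Subtype.ext
  refine AffineSubspace.ext_of_direction_eq (by simp [lineThrough]) ⟨x, ?_, ?_⟩
  · exact AffineSubspace.self_mem_mk' _ _
  · simpa [lineThrough, AffineSubspace.mem_mk'] using h

/-- The disintegration of the invariant line measure along directions. -/
theorem lineMeasure_apply (d : ℕ) {A : Set (Line d)} (hA : MeasurableSet A) :
    lineMeasure d A = (2 * volume (Metric.ball (0 : E (d - 1)) 1))⁻¹ *
      ∫⁻ e : Metric.sphere (0 : E d) 1,
        volume {y : ((ℝ ∙ (e : E d))ᗮ : Submodule ℝ (E d)) | lineThrough e (y : E d) ∈ A}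
          ∂(volume : Measure (E d)).toSphere := by
  have hm := measurable_lineThrough d hA
  rw [lineMeasure, Measure.smul_apply, Measure.map_apply (measurable_lineThrough d) hA,
    Measure.restrict_apply hm, Measure.prod_apply (hm.inter (measurableSet_slab d)), smul_eq_mul]
  congr 1
  refine lintegral_congr fun e => ?_
  have he : ‖(e : E d)‖ = 1 := by simp
  set S : Set (E d) := Prod.mk e ⁻¹' ((fun p : Metric.sphere (0 : E d) 1 × E d =>
    lineThrough p.1 p.2) ⁻¹' A ∩ slab d) with hS
  set K : Submodule ℝ (E d) := ℝ ∙ (e : E d) with hK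
  set B : Set Kᗮ := {y | lineThrough e (y : E d) ∈ A} with hB
  have hmp : MeasurePreserving (fun q : K × Kᗮ => (q.1 : E d) + (q.2 : E d)) volume volume :=
    (K.orthogonalDecomposition.symm.measurePreserving).comp (WithLp.volume_preserving_toLp K Kᗮ)
  have hS_meas : MeasurableSet S :=
    measurable_prodMk_left (hm.inter (measurableSet_slab d))
  have hpre : (fun q : K × Kᗮ => (q.1 : E d) + (q.2 : E d)) ⁻¹' S =
      {a : K | inner ℝ (e : E d) (a : E d) ∈ Ico (0 : ℝ) 1} ×ˢ B := by
    ext ⟨a, b⟩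
    have hb : inner ℝ (e : E d) (b : E d) = 0 :=
      Submodule.mem_orthogonal_singleton_iff_inner_right.mp b.2
    have hl : lineThrough e ((a : E d) + (b : E d)) = lineThrough e (b : E d) :=
      lineThrough_eq e (by rw [add_sub_cancel_right]; exact a.2)
    simp [hS, hB, slab, inner_add_right, hb, hl, and_comm]
  have hone : volume {a : K | inner ℝ (e : E d) (a : E d) ∈ Ico (0 : ℝ) 1} = 1 := by
    have h := (LinearIsometryEquiv.toSpanUnitSingleton (𝕜 := ℝ) (e : E d) he).measurePreserving
    rw [← h.measure_preimage_equiv (f := (LinearIsometryEquiv.toSpanUnitSingleton (𝕜 := ℝ)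
      (e : E d) he).toHomeomorph.toMeasurableEquiv)]
    have : (LinearIsometryEquiv.toSpanUnitSingleton (𝕜 := ℝ)
      (e : E d) he).toHomeomorph.toMeasurableEquiv ⁻¹'
        {a : K | inner ℝ (e : E d) (a : E d) ∈ Ico (0 : ℝ) 1} = Ico (0 : ℝ) 1 := by
      ext t
      change inner ℝ (e : E d) (t • (e : E d)) ∈ Ico (0 : ℝ) 1 ↔ t ∈ Ico (0 : ℝ) 1
      rw [inner_smul_right, real_inner_self_eq_norm_sq, he, one_pow, mul_one]
    rw [this]
    simp
  rw [← hmp.measure_preimage hS_meas.nullMeasurableSet, hpre, Measure.volume_eq_prod,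
    Measure.prod_prod, hone, one_mul]

/-! ### The improper Poisson process of marked lines -/

/-- The intensity `(γ - 1) v^(-γ) dv μ_d(dl)` on lines marked by a speed-limit `v > 0`. -/
def intensity (d : ℕ) (γ : ℝ) : Measure (Line d × ℝ) :=
  (lineMeasure d).prod
    ((volume.restrict (Ioi (0 : ℝ))).withDensity fun v => ENNReal.ofReal ((γ - 1) * v ^ (-γ)))

/-- The random set `N` is a Poisson point process with (`σ`-finite, diffuse) intensity `Λ`: counts
in measurable sets are random variables, those of sets of finite mass are Poisson with this mass as
mean, and those of pairwise disjoint sets are independent. (Counts of sets of infinite mass are then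
almost surely infinite.) -/
structure IsPoissonProcess {Ω : Type*} [MeasurableSpace Ω] (P : Measure Ω)
    {X : Type*} [MeasurableSpace X] (Λ : Measure X) (N : Ω → Set X) : Prop where
  measurable_count : ∀ B : Set X, MeasurableSet B → Measurable fun ω => (N ω ∩ B).encard
  poisson_count : ∀ B : Set X, MeasurableSet B → Λ B ≠ ∞ → ∀ k : ℕ,
    P {ω | (N ω ∩ B).encard = k} = poissonMeasure (Λ B).toNNReal {k}
  indep_count : ∀ (n : ℕ) (B : Fin n → Set X), (∀ i, MeasurableSet (B i)) →
    Pairwise (Function.onFun Disjoint B) → iIndepFun (fun i ω => (N ω ∩ B i).encard) P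

/-! ### Paths obeying the speed-limits, and geodesics -/

/-- The silhouette `S_v`: the union of all lines of speed-limit at least `v`. -/
def silhouette {d : ℕ} (N : Set (Line d × ℝ)) (v : ℝ) : Set (E d) :=
  ⋃ p ∈ {p ∈ N | v ≤ p.2}, p.1.points

/-- The restriction of `ξ` to `[0, T)` is a `Π`-path with (finite) terminal time `T > 0`, for the
pattern `N` of marked lines. Only the values of `ξ` on `[0, T)` matter; a locally Lipschitz `ξ` is
differentiable at almost every time. -/
structure IsPiPath {d : ℕ} (N : Set (Line d × ℝ)) (T : ℝ) (ξ : ℝ → E d) : Prop where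
  pos : 0 < T
  locallyLipschitz : LocallyLipschitzOn (Ico 0 T) ξ
  speed_limit : ∀ v : ℝ, 0 < v →
    volume {t ∈ Ico 0 T | v < ‖deriv ξ t‖ ∧ ξ t ∉ silhouette N v} = 0

/-- `ξ` is a `Π`-path with terminal time `T` which leads from `x` at time `0` to `y` at time `T`,
its value at `T` being the one given by continuity. -/
structure Connects {d : ℕ} (N : Set (Line d × ℝ)) (T : ℝ) (ξ : ℝ → E d) (x y : E d) : Prop where
  isPiPath : IsPiPath N T ξ
  continuousOn : ContinuousOn ξ (Icc 0 T)
  initial : ξ 0 = x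
  terminal : ξ T = y

/-- `ξ`, on `[0, T]`, is a `Π`-geodesic (minimum-time `Π`-path) from `x` to `y`. -/
structure IsPiGeodesic {d : ℕ} (N : Set (Line d × ℝ)) (T : ℝ) (ξ : ℝ → E d) (x y : E d) :
    Prop where
  connects : Connects N T ξ x y
  minimal : ∀ S : ℝ, S < T → ¬ ∃ η : ℝ → E d, Connects N S η x y

end PoissonRoads

end

noncomputable section

namespace PoissonRoads

/-! ### Relaxed paths -/

/-! A geodesic is obtained by the direct method: a limit of nearly time-minimal curves. The
speed-limits are recast without derivatives as `IsRelaxedPath`, where limits below `ε` are ignored,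
so that speed `ε` is allowed everywhere. This form survives concatenation and limits, and every
genuine path satisfies it. With `T₀` the infimum of the times in which the endpoints are joined for
all `ε`, curves with `T → T₀` and `ε → 0` have a limit, which is a genuine path of duration `T₀` and
hence minimal (`exists_isPiGeodesic`).

Three almost sure facts feed this argument. Fast lines are locally finite (`ae_finite_fastLines`),
so silhouettes are locally closed. Some large ball is met by no line fast enough to carry a path out
of it in the given time (`ae_exists_slowIn`), which confines the curves and makes them
equi-Lipschitz. The endpoints are joined in a time independent of `ε`
(`exists_time_relaxedJoin_of_linkedAt`): two points at distance `α ^ n` are linked by a fast line up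
to two gaps of size `α ^ (n + 1)`, recursively, at summable cost.

The assumption `γ > d` acts twice through scaling: lines of speed of order `R` near a ball of radius
`R` have intensity of order `R ^ (d - γ)`, which vanishes for large `R`, and it makes useful lines
abundant at small scales, so that `ae_eventually_linkedAt` follows from Borel–Cantelli. -/

/-- A Lipschitz curve whose derivative is almost everywhere of norm at most `v` moves at speed at
most `v`. -/
theorem dist_le_of_ae_norm_deriv_le {d : ℕ} {f : ℝ → E d} {a b v : ℝ} {K : ℝ≥0} (hab : a ≤ b)
    (hf : LipschitzOnWith K f (Icc a b))
    (hv : ∀ᵐ t, t ∈ Icc a b → ‖deriv f t‖ ≤ v) : dist (f a) (f b) ≤ v * (b - a) := by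
  -- Pairing with the total displacement reduces to a real function, whose increment is `‖u‖ * ‖u‖`
  -- and at most `‖u‖ * v * (b - a)`.
  set u : E d := f b - f a with hu
  set g : ℝ → ℝ := fun t => innerSL ℝ u (f t) with hg
  have hgl : LipschitzOnWith (‖innerSL ℝ u‖₊ * K) g (uIcc a b) := by
    rw [uIcc_of_le hab]
    exact (innerSL ℝ u).lipschitz.comp_lipschitzOnWith hf
  have hint := hgl.absolutelyContinuousOnInterval.integral_deriv_eq_sub
  have hdiff := hf.ae_differentiableWithinAt_of_mem_real
  have hb : ‖∫ t in a..b, deriv g t‖ ≤ (‖u‖ * v) * |b - a| := by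
    refine intervalIntegral.norm_integral_le_of_norm_le_const_ae ?_
    have hne : ∀ᵐ t : ℝ, t ≠ b := by simp [ae_iff]
    filter_upwards [hv, hdiff, hne] with t ht hd hb htab
    rw [uIoc_of_le hab] at htab
    have htI : t ∈ Icc a b := Ioc_subset_Icc_self htab
    have hnh : Icc a b ∈ 𝓝 t := Icc_mem_nhds htab.1 (lt_of_le_of_ne htab.2 hb)
    have hD := ((hd htI).differentiableAt hnh).hasDerivAt
    have hD' : HasDerivAt g (innerSL ℝ u (deriv f t)) t :=
      (innerSL ℝ u).hasFDerivAt.comp_hasDerivAt t hD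
    rw [hD'.deriv]
    calc ‖innerSL ℝ u (deriv f t)‖ ≤ ‖u‖ * ‖deriv f t‖ := norm_inner_le_norm (𝕜 := ℝ) u _
      _ ≤ ‖u‖ * v := by gcongr; exact ht htI
  rw [hint, abs_of_nonneg (sub_nonneg.2 hab)] at hb
  have hsq : g b - g a = ‖u‖ * ‖u‖ := by
    simp only [hg]
    rw [← map_sub, ← hu, innerSL_apply_apply, real_inner_self_eq_norm_mul_norm]
  rw [hsq, norm_mul, norm_norm, mul_assoc] at hb
  rw [dist_comm, dist_eq_norm]
  -- When `u = 0` the claim is `0 ≤ v * (b - a)`; the sign of `v` comes from the derivative bound,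
  -- which holds somewhere on an interval of positive length.
  rcases (norm_nonneg u).eq_or_lt with h0 | h0
  · rw [← hu, ← h0]
    rcases hab.eq_or_lt with rfl | hlt
    · simp
    · have : ∃ t, t ∈ Icc a b ∧ ‖deriv f t‖ ≤ v := by
        by_contra! hcon
        have : volume (Icc a b) = 0 := by
          rw [measure_eq_zero_iff_ae_notMem]
          filter_upwards [hv] with t ht htm
          exact (hcon t htm).not_ge (ht htm)
        rw [Real.volume_Icc, ENNReal.ofReal_eq_zero] at this
        linarith
      obtain ⟨t, -, ht⟩ := this
      exact mul_nonneg ((norm_nonneg _).trans ht) (sub_nonneg.2 hab)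
  · exact le_of_mul_le_mul_left hb h0

/-- A curve on `[0, T]` that obeys the speed-limits `v ≥ ε`, these being expressed without
derivatives. -/
structure IsRelaxedPath {d : ℕ} (N : Set (Line d × ℝ)) (ε T : ℝ) (ξ : ℝ → E d) : Prop where
  continuousOn : ContinuousOn ξ (Icc 0 T)
  dist_le : ∀ v : ℝ, 0 < v → ε ≤ v → ∀ a b : ℝ, 0 ≤ a → a ≤ b → b ≤ T →
    (∀ t ∈ Icc a b, ξ t ∉ silhouette N v) → dist (ξ a) (ξ b) ≤ v * (b - a)

/-- A relaxed path leads from `x` to `y` in time `T`. -/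
def RelaxedJoin {d : ℕ} (N : Set (Line d × ℝ)) (ε T : ℝ) (x y : E d) : Prop :=
  ∃ ξ : ℝ → E d, IsRelaxedPath N ε T ξ ∧ ξ 0 = x ∧ ξ T = y

/-- Local Lipschitz continuity is uniform on compact subintervals of `[0, T)`, so the derivative
bound integrates there; the endpoint `T` is reached by continuity. -/
theorem Connects.relaxedJoin {d : ℕ} {N : Set (Line d × ℝ)} {T : ℝ} {ξ : ℝ → E d} {x y : E d}
    (h : Connects N T ξ x y) (ε : ℝ) : RelaxedJoin N ε T x y := by
  refine ⟨ξ, ⟨h.continuousOn, ?_⟩, h.initial, h.terminal⟩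
  intro v hv _ a b ha hab hbT hav
  have key : ∀ c, a ≤ c → c ≤ b → c < T → dist (ξ a) (ξ c) ≤ v * (c - a) := by
    intro c hac hcb hcT
    have hsub : Icc a c ⊆ Ico 0 T := fun t ht => ⟨ha.trans ht.1, ht.2.trans_lt hcT⟩
    obtain ⟨K, hK⟩ := (h.isPiPath.locallyLipschitz.mono hsub).exists_lipschitzOnWith_of_compact
      isCompact_Icc
    refine dist_le_of_ae_norm_deriv_le hac hK ?_
    have h0 := measure_eq_zero_iff_ae_notMem.1 (h.isPiPath.speed_limit v hv)
    filter_upwards [h0] with t ht htm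
    by_contra! hlt
    exact ht ⟨hsub htm, hlt, hav t ⟨htm.1, htm.2.trans hcb⟩⟩
  rcases hbT.lt_or_eq with hlt | rfl
  · exact key b hab le_rfl hlt
  · rcases hab.eq_or_lt with rfl | hlt
    · simp
    · have hc : Tendsto ξ (𝓝[<] b) (𝓝 (ξ b)) := by
        refine (h.continuousOn b ⟨ha.trans hab, le_rfl⟩).mono_left ?_
        rw [← nhdsWithin_Ioo_eq_nhdsLT (ha.trans_lt hlt)]
        exact nhdsWithin_mono _ Ioo_subset_Icc_self
      have hr : Tendsto (fun c => v * (c - a)) (𝓝[<] b) (𝓝 (v * (b - a))) :=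
        ((by fun_prop : Continuous fun c : ℝ => v * (c - a)).tendsto b).mono_left
          nhdsWithin_le_nhds
      refine le_of_tendsto_of_tendsto (tendsto_const_nhds.dist hc) hr ?_
      filter_upwards [Ioo_mem_nhdsLT hlt] with c hcm
      exact key c hcm.1.le hcm.2.le hcm.2

theorem relaxedJoin_segment {d : ℕ} {N : Set (Line d × ℝ)} {ε T : ℝ} {x y : E d} (hT : 0 ≤ T)
    (h : ∀ v, 0 < v → ε ≤ v → (∀ s : ℝ, AffineMap.lineMap x y s ∈ silhouette N v) ∨
      dist x y ≤ v * T) (hxy : T = 0 → x = y) : RelaxedJoin N ε T x y := by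
  refine ⟨fun t => AffineMap.lineMap x y (t / T), ⟨?_, ?_⟩, ?_, ?_⟩
  · refine Continuous.continuousOn ?_
    exact AffineMap.lineMap_continuous.comp (by fun_prop)
  · intro v hv hε a b ha hab hbT hav
    rcases h v hv hε with hs | hd
    · exact absurd (hs (a / T)) (hav a ⟨le_rfl, hab⟩)
    · rw [dist_lineMap_lineMap, Real.dist_eq]
      -- For `T = 0` the convention `t / 0 = 0` makes the curve constant.
      rcases hT.eq_or_lt with rfl | hT
      · simp only [div_zero, sub_zero, abs_zero, zero_mul]
        exact mul_nonneg hv.le (sub_nonneg.2 hab)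
      · rw [← sub_div, abs_div, abs_of_pos hT, abs_sub_comm, abs_of_nonneg (sub_nonneg.2 hab)]
        rw [div_mul_eq_mul_div, div_le_iff₀ hT]
        nlinarith [mul_le_mul_of_nonneg_left hd (sub_nonneg.2 hab)]
  · simp
  · rcases eq_or_ne T 0 with h0 | h0
    · simp [h0, hxy h0]
    · simp [h0]

theorem relaxedJoin_of_dist_le {d : ℕ} {N : Set (Line d × ℝ)} {ε T : ℝ} {x y : E d} (hT : 0 ≤ T)
    (h : dist x y ≤ ε * T) : RelaxedJoin N ε T x y := by
  refine relaxedJoin_segment hT (fun v _ hv => Or.inr (h.trans (by gcongr))) ?_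
  rintro rfl
  rw [mul_zero] at h
  exact dist_le_zero.1 h

theorem relaxedJoin_of_mem_points {d : ℕ} {N : Set (Line d × ℝ)} {ε T : ℝ} {x y : E d}
    (hT : 0 ≤ T) {p : Line d × ℝ} (hp : p ∈ N) (hx : x ∈ p.1.points) (hy : y ∈ p.1.points)
    (h : dist x y ≤ p.2 * T) : RelaxedJoin N ε T x y := by
  refine relaxedJoin_segment hT (fun v _ _ => ?_) ?_
  · rcases le_total v p.2 with hv | hv
    · refine Or.inl fun s => mem_iUnion₂.2 ⟨p, ⟨hp, hv⟩, ?_⟩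
      exact AffineMap.lineMap_mem (Q := p.1.1) s hx hy
    · exact Or.inr (h.trans (by gcongr))
  · rintro rfl
    rw [mul_zero] at h
    exact dist_le_zero.1 h

theorem RelaxedJoin.trans {d : ℕ} {N : Set (Line d × ℝ)} {ε T S : ℝ} {x y z : E d} (hT : 0 ≤ T)
    (hS : 0 ≤ S) (h : RelaxedJoin N ε T x y) (h' : RelaxedJoin N ε S y z) :
    RelaxedJoin N ε (T + S) x z := by
  obtain ⟨ξ, hξ, hx, hy⟩ := h
  obtain ⟨η, hη, hy', hz⟩ := h'
  set ζ : ℝ → E d := fun t => if t ≤ T then ξ t else η (t - T) with hζ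
  have h1 : ∀ t, t ≤ T → ζ t = ξ t := fun t ht => if_pos ht
  have h2 : ∀ t, T ≤ t → ζ t = η (t - T) := fun t ht => by
    rcases ht.eq_or_lt with rfl | ht
    · rw [h1 _ le_rfl, sub_self, hy, hy']
    · exact if_neg ht.not_ge
  refine ⟨ζ, ⟨?_, ?_⟩, by rw [h1 _ hT, hx], by rw [h2 _ (by linarith), add_sub_cancel_left, hz]⟩
  · have e : Icc (0 : ℝ) (T + S) = Icc 0 T ∪ Icc T (T + S) :=
      (Icc_union_Icc_eq_Icc hT (by linarith)).symm
    rw [e]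
    refine ContinuousOn.union_of_isClosed ?_ ?_ isClosed_Icc isClosed_Icc
    · exact hξ.continuousOn.congr fun t ht => h1 t ht.2
    · refine ContinuousOn.congr (f := fun t => η (t - T)) ?_ fun t ht => h2 t ht.1
      refine hη.continuousOn.comp (by fun_prop) fun t ht => ⟨?_, ?_⟩
      · linarith [ht.1]
      · linarith [ht.2]
  · intro v hv hε a b ha hab hb hav
    have k1 : ∀ a b, 0 ≤ a → a ≤ b → b ≤ T → (∀ t ∈ Icc a b, ζ t ∉ silhouette N v) →
        dist (ζ a) (ζ b) ≤ v * (b - a) := by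
      intro a b ha hab hb hav
      rw [h1 a (hab.trans hb), h1 b hb]
      refine hξ.dist_le v hv hε a b ha hab hb fun t ht => ?_
      rw [← h1 t (ht.2.trans hb)]
      exact hav t ht
    have k2 : ∀ a b, T ≤ a → a ≤ b → b ≤ T + S → (∀ t ∈ Icc a b, ζ t ∉ silhouette N v) →
        dist (ζ a) (ζ b) ≤ v * (b - a) := by
      intro a b ha hab hb hav
      rw [h2 a ha, h2 b (ha.trans hab)]
      refine (hη.dist_le v hv hε (a - T) (b - T) (by linarith) (by linarith) (by linarith)
        fun t ht => ?_).trans_eq (by ring)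
      have := hav (t + T) ⟨by linarith [ht.1], by linarith [ht.2]⟩
      rwa [h2 _ (by linarith [ht.1]), add_sub_cancel_right] at this
    rcases le_total b T with hbT | hbT
    · exact k1 a b ha hab hbT hav
    rcases le_total T a with haT | haT
    · exact k2 a b haT hab hb hav
    -- An interval straddling the junction is cut there; both halves still avoid the silhouette.
    have i1 := k1 a T ha haT le_rfl fun t ht => hav t ⟨ht.1, ht.2.trans hbT⟩
    have i2 := k2 T b le_rfl hbT hb fun t ht => hav t ⟨haT.trans ht.1, ht.2⟩
    linarith [dist_triangle (ζ a) (ζ T) (ζ b)]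

theorem RelaxedJoin.mono_time {d : ℕ} {N : Set (Line d × ℝ)} {ε T S : ℝ} {x y : E d} (hε : 0 ≤ ε)
    (hT : 0 ≤ T) (hTS : T ≤ S) (h : RelaxedJoin N ε T x y) : RelaxedJoin N ε S x y := by
  have h0 : RelaxedJoin N ε (S - T) y y :=
    relaxedJoin_of_dist_le (sub_nonneg.2 hTS) (by
      rw [dist_self]; exact mul_nonneg hε (sub_nonneg.2 hTS))
  simpa using h.trans hT (sub_nonneg.2 hTS) h0

/-! ### Confinement and compactness -/

/-- No line of `N` with speed-limit at least `V` meets the closed ball of radius `R` about `0`. -/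
def SlowIn {d : ℕ} (N : Set (Line d × ℝ)) (V R : ℝ) : Prop :=
  Disjoint (silhouette N V) (Metric.closedBall 0 R)

/-- Up to the first time at norm `R` the path stays where no line of speed `V` or more is available,
so it has moved at most `V * T`, too little to get there. -/
theorem IsRelaxedPath.norm_le {d : ℕ} {N : Set (Line d × ℝ)} {ε T V R : ℝ} {ξ : ℝ → E d}
    (h : IsRelaxedPath N ε T ξ) (hV : 0 < V) (hεV : ε ≤ V) (hN : SlowIn N V R)
    (hR : ‖ξ 0‖ + V * T < R) {t : ℝ} (ht : t ∈ Icc 0 T) : ‖ξ t‖ ≤ R := by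
  by_contra! hcon
  have hc : IsCompact (Icc 0 T ∩ (fun t => ‖ξ t‖) ⁻¹' Ici R) :=
    isCompact_Icc.of_isClosed_subset
      (h.continuousOn.norm.preimage_isClosed_of_isClosed isClosed_Icc isClosed_Ici)
      inter_subset_left
  obtain ⟨s, ⟨hsI, hsR⟩, hs⟩ := hc.exists_isLeast ⟨t, ht, hcon.le⟩
  have hlt : ∀ r ∈ Icc 0 s, r ≠ s → ‖ξ r‖ < R := fun r hr hne => by
    by_contra! hge
    exact hne (le_antisymm hr.2 (hs ⟨⟨hr.1, hr.2.trans hsI.2⟩, hge⟩))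
  have h0R : ‖ξ 0‖ < R := by nlinarith [hsI.1, hsI.2]
  have hseq : ‖ξ s‖ = R := by
    have hcont : ContinuousOn (fun t => ‖ξ t‖) (Icc 0 s) :=
      h.continuousOn.norm.mono (Icc_subset_Icc_right hsI.2)
    obtain ⟨r, hr, hrR⟩ := intermediate_value_Icc hsI.1 hcont ⟨h0R.le, hsR⟩
    by_cases hne : r = s
    · rw [← hne]; exact hrR
    · exact absurd hrR (hlt r hr hne).ne
  have hd := h.dist_le V hV hεV 0 s le_rfl hsI.1 hsI.2 fun r hr hmem => by
    refine Set.disjoint_left.1 hN hmem ?_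
    rw [mem_closedBall_zero_iff]
    by_cases hne : r = s
    · rw [hne, hseq]
    · exact (hlt r hr hne).le
  have : ‖ξ s‖ ≤ ‖ξ 0‖ + dist (ξ 0) (ξ s) := by
    rw [dist_comm, dist_eq_norm]
    simpa using norm_add_le (ξ 0) (ξ s - ξ 0)
  nlinarith [hsI.2]

/-- The Lipschitz constant does not depend on `ε`: this is the equicontinuity behind the compactness
argument. -/
theorem IsRelaxedPath.dist_le_of_slowIn {d : ℕ} {N : Set (Line d × ℝ)} {ε T V R : ℝ}
    {ξ : ℝ → E d} (h : IsRelaxedPath N ε T ξ) (hV : 0 < V) (hεV : ε ≤ V) (hN : SlowIn N V R)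
    (hR : ‖ξ 0‖ + V * T < R) {s t : ℝ} (hs : s ∈ Icc 0 T) (ht : t ∈ Icc 0 T) :
    dist (ξ s) (ξ t) ≤ V * |s - t| := by
  have key : ∀ s t, s ∈ Icc 0 T → t ∈ Icc 0 T → s ≤ t → dist (ξ s) (ξ t) ≤ V * (t - s) := by
    intro s t hs ht hst
    refine h.dist_le V hV hεV s t hs.1 hst ht.2 fun r hr hmem => ?_
    refine Set.disjoint_left.1 hN hmem ?_
    rw [mem_closedBall_zero_iff]
    exact h.norm_le hV hεV hN hR ⟨hs.1.trans hr.1, hr.2.trans ht.2⟩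
  rcases le_total s t with hst | hst
  · rw [abs_sub_comm, abs_of_nonneg (sub_nonneg.2 hst)]
    exact key s t hs ht hst
  · rw [abs_of_nonneg (sub_nonneg.2 hst), dist_comm]
    exact key t s ht hs hst

/-- The marked lines of `N` of speed-limit at least `v` that meet a closed ball about `0`. -/
def fastLines {d : ℕ} (N : Set (Line d × ℝ)) (v R : ℝ) : Set (Line d × ℝ) :=
  {p ∈ N | v ≤ p.2 ∧ (p.1.points ∩ Metric.closedBall 0 R).Nonempty}

theorem isClosed_silhouette_inter {d : ℕ} {N : Set (Line d × ℝ)} {v R : ℝ}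
    (h : (fastLines N v R).Finite) : IsClosed (silhouette N v ∩ Metric.closedBall 0 R) := by
  have e : silhouette N v ∩ Metric.closedBall 0 R =
      ⋃ p ∈ fastLines N v R, p.1.points ∩ Metric.closedBall 0 R := by
    ext z
    simp only [silhouette, fastLines, mem_inter_iff, mem_iUnion, exists_prop]
    constructor
    · rintro ⟨⟨p, ⟨hp, hv⟩, hz⟩, hzR⟩
      exact ⟨p, ⟨hp, hv, z, hz, hzR⟩, hz, hzR⟩
    · rintro ⟨p, ⟨hp, hv, -⟩, hz, hzR⟩
      exact ⟨⟨p, ⟨hp, hv⟩, hz⟩, hzR⟩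
  rw [e]
  refine h.isClosed_biUnion fun p _ => ?_
  exact (AffineSubspace.closed_of_finiteDimensional p.1.1).inter Metric.isClosed_closedBall

/-- Existence of geodesics for a pattern with locally finitely many fast lines, in which paths
cannot escape in finite time, and in which `x` and `y` are joined by relaxed paths in bounded
time. -/
theorem exists_isPiGeodesic {d : ℕ} {N : Set (Line d × ℝ)} {x y : E d} (hxy : x ≠ y)
    (hfin : ∀ v : ℝ, 0 < v → ∀ R : ℝ, (fastLines N v R).Finite)
    (hslow : ∀ T : ℝ, 0 ≤ T → ∃ V R : ℝ, 0 < V ∧ ‖x‖ + V * T < R ∧ SlowIn N V R)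
    (hjoin : ∃ T : ℝ, 0 ≤ T ∧ ∀ ε : ℝ, 0 < ε → RelaxedJoin N ε T x y) :
    ∃ (T : ℝ) (ξ : ℝ → E d), IsPiGeodesic N T ξ x y := by
  set A : Set ℝ := {T | 0 ≤ T ∧ ∀ ε : ℝ, 0 < ε → RelaxedJoin N ε T x y} with hA
  have hAne : A.Nonempty := hjoin
  have hAb : BddBelow A := ⟨0, fun T hT => hT.1⟩
  set T₀ := sInf A with hT₀
  have hT₀0 : 0 ≤ T₀ := le_csInf hAne fun T hT => hT.1
  -- The margin `1` lets a single ball confine all approximating curves, whose durations are at most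
  -- `T₀ + 1`.
  obtain ⟨V, R, hV, hR, hN⟩ := hslow (T₀ + 1) (by positivity)
  have hex : ∀ n : ℕ, ∃ T ∈ A, T < T₀ + 1 / ((n : ℝ) + 1) := fun n =>
    exists_lt_of_csInf_lt hAne (by rw [← hT₀]; linarith [Nat.one_div_pos_of_nat (α := ℝ) (n := n)])
  choose T hTA hTlt using hex
  have hTge : ∀ n, T₀ ≤ T n := fun n => csInf_le hAb (hTA n)
  have hTle : ∀ n, T n ≤ T₀ + 1 := fun n => by
    have : 1 / ((n : ℝ) + 1) ≤ 1 := by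
      rw [div_le_one (by positivity)]; linarith [Nat.cast_nonneg (α := ℝ) n]
    linarith [hTlt n]
  -- Truncation at `V` keeps the limit `V` among those obeyed, as confinement requires.
  set ε : ℕ → ℝ := fun n => min V (1 / ((n : ℝ) + 1)) with hε
  have hε0 : ∀ n, 0 < ε n := fun n => lt_min hV Nat.one_div_pos_of_nat
  have hεV : ∀ n, ε n ≤ V := fun n => min_le_left _ _
  choose ξ hξ hξ0 hξT using fun n => (hTA n).2 (ε n) (hε0 n)
  have hRn : ∀ n, ‖ξ n 0‖ + V * T n < R := fun n => by
    rw [hξ0]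
    nlinarith [hTle n]
  -- Clamping time to `[0, T n]` is 1-Lipschitz and puts all curves on the common domain `ℝ`.
  set c : ℕ → ℝ → ℝ := fun n t => max 0 (min t (T n)) with hc
  have hcm : ∀ n t, c n t ∈ Icc 0 (T n) := fun n t =>
    ⟨le_max_left _ _, max_le (hTA n).1 (min_le_right _ _)⟩
  have hcid : ∀ n t, t ∈ Icc 0 (T n) → c n t = t := fun n t ht => by
    simp only [hc]; rw [min_eq_left ht.2, max_eq_right ht.1]
  have hclip : ∀ n s t, |c n s - c n t| ≤ |s - t| := fun n s t => by
    simp only [hc]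
    calc _ ≤ |min s (T n) - min t (T n)| := by
          rw [max_comm 0, max_comm 0]; exact abs_max_sub_max_le_abs _ _ _
      _ ≤ |s - t| := by
          refine (abs_min_sub_min_le_max _ _ _ _).trans ?_
          simp
  set ζ : ℕ → ℝ → E d := fun n t => ξ n (c n t) with hζ
  have hζR : ∀ n t, ζ n t ∈ Metric.closedBall (0 : E d) R := fun n t => by
    rw [mem_closedBall_zero_iff]
    exact (hξ n).norm_le hV (hεV n) hN (hRn n) (hcm n t)
  have hζl : ∀ n s t, dist (ζ n s) (ζ n t) ≤ V * |s - t| := fun n s t =>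
    ((hξ n).dist_le_of_slowIn hV (hεV n) hN (hRn n) (hcm n s) (hcm n t)).trans
      (mul_le_mul_of_nonneg_left (hclip n s t) hV.le)
  -- Pointwise limits along an ultrafilter replace Arzelà–Ascoli; the uniform Lipschitz bound passes
  -- to them.
  have hlim : ∀ t, ∃ z ∈ Metric.closedBall (0 : E d) R,
      Tendsto (fun n => ζ n t) (hyperfilter ℕ : Filter ℕ) (𝓝 z) := fun t => by
    obtain ⟨z, hz, hle⟩ := (isCompact_closedBall (0 : E d) R).ultrafilter_le_nhds'
      ((hyperfilter ℕ).map fun n => ζ n t) (Ultrafilter.mem_map.2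
        (Filter.univ_mem' (f := (hyperfilter ℕ : Filter ℕ)) fun n => hζR n t))
    exact ⟨z, hz, hle⟩
  choose φ hφR hφ using hlim
  have hat : (hyperfilter ℕ : Filter ℕ) ≤ atTop := Nat.hyperfilter_le_atTop
  have hφl : ∀ s t, dist (φ s) (φ t) ≤ V * |s - t| := fun s t =>
    le_of_tendsto' ((hφ s).dist (hφ t)) fun n => hζl n s t
  have hφ0 : φ 0 = x := by
    refine tendsto_nhds_unique (hφ 0) (tendsto_const_nhds.congr fun n => ?_)
    simp only [hζ]
    rw [hcid n 0 ⟨le_rfl, (hTA n).1⟩, hξ0]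
  have hone : Tendsto (fun n : ℕ => 1 / ((n : ℝ) + 1)) (hyperfilter ℕ : Filter ℕ) (𝓝 0) :=
    tendsto_one_div_add_atTop_nhds_zero_nat.mono_left hat
  have hφT : φ T₀ = y := by
    refine tendsto_nhds_unique (hφ T₀) ?_
    rw [tendsto_iff_dist_tendsto_zero]
    have hb : Tendsto (fun n : ℕ => V * (1 / ((n : ℝ) + 1))) (hyperfilter ℕ : Filter ℕ) (𝓝 0) := by
      simpa using hone.const_mul V
    refine squeeze_zero (fun _ => dist_nonneg) (fun n => ?_) hb
    have h1 : ζ n (T n) = y := by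
      simp only [hζ]; rw [hcid n _ ⟨(hTA n).1, le_rfl⟩, hξT]
    rw [← h1]
    refine (hζl n _ _).trans ?_
    gcongr
    rw [abs_sub_comm, abs_of_nonneg (sub_nonneg.2 (hTge n))]
    linarith [hTlt n]
  have hT₀pos : 0 < T₀ := by
    refine hT₀0.lt_of_ne fun h0 => hxy ?_
    rw [← hφ0, ← hφT, ← h0]
  have hLip : LipschitzWith V.toNNReal φ := LipschitzWith.of_dist_le_mul fun s t => by
    rw [Real.coe_toNNReal _ hV.le, Real.dist_eq]
    exact hφl s t
  -- Off the locally closed silhouette the limit has a neighbourhood free of it. Near time `t` the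
  -- curves `ζ n` lie in that neighbourhood for ultrafilter-many `n`, hence obey the limit `v` as
  -- soon as `ε n ≤ v`.
  have hspeed : ∀ v, 0 < v → ∀ t ∈ Ioo 0 T₀, φ t ∉ silhouette N v → ‖deriv φ t‖ ≤ v := by
    intro v hv t ht hnot
    refine norm_deriv_le_of_lip' hv.le ?_
    have hopen : (silhouette N v ∩ Metric.closedBall 0 R)ᶜ ∈ 𝓝 (φ t) :=
      (isClosed_silhouette_inter (hfin v hv R)).isOpen_compl.mem_nhds fun h => hnot h.1
    obtain ⟨δ, hδ, hball⟩ := Metric.mem_nhds_iff.1 hopen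
    -- In this time a `V`-Lipschitz curve moves less than `δ / 2`; the other half of `δ` is the
    -- error of `ζ n t`.
    have hη : 0 < δ / (2 * V) := by positivity
    filter_upwards [Metric.ball_mem_nhds t hη, Ioo_mem_nhds ht.1 ht.2] with s hsη hs
    rw [← dist_eq_norm, Real.norm_eq_abs]
    have hev : ∀ᶠ n in (hyperfilter ℕ : Filter ℕ), dist (ζ n s) (ζ n t) ≤ v * |s - t| := by
      filter_upwards [(hφ t).eventually (Metric.ball_mem_nhds (φ t) (half_pos hδ)),
        hone.eventually (gt_mem_nhds hv)] with n hn1 hn2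
      have hεv : ε n ≤ v := (min_le_right _ _).trans hn2.le
      have havoid : ∀ r, r ∈ Ioo 0 T₀ → |r - t| ≤ |s - t| → ξ n r ∉ silhouette N v := by
        intro r hr hrt hmem
        have hid : ζ n r = ξ n r := by
          simp only [hζ]; rw [hcid n r ⟨hr.1.le, hr.2.le.trans (hTge n)⟩]
        have h1 : dist (ξ n r) (φ t) < δ := by
          rw [← hid]
          have h2 : V * |s - t| < δ / 2 := by
            rw [Metric.mem_ball, Real.dist_eq, lt_div_iff₀ (by positivity)] at hsη
            linarith
          have h3 := hζl n r t
          have h4 : V * |r - t| ≤ V * |s - t| := by gcongr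
          have h5 : dist (ζ n t) (φ t) < δ / 2 := hn1
          linarith [dist_triangle (ζ n r) (ζ n t) (φ t)]
        exact hball (Metric.mem_ball.2 h1) ⟨hmem, hid ▸ hζR n r⟩
      have hids : ∀ r ∈ Ioo 0 T₀, ζ n r = ξ n r := fun r hr => by
        simp only [hζ]; rw [hcid n r ⟨hr.1.le, hr.2.le.trans (hTge n)⟩]
      rw [hids s hs, hids t ht]
      rcases le_total s t with hst | hst
      · rw [abs_sub_comm, abs_of_nonneg (sub_nonneg.2 hst)]
        refine (hξ n).dist_le v hv hεv s t hs.1.le hst (ht.2.le.trans (hTge n)) fun r hr => ?_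
        refine havoid r ⟨hs.1.trans_le hr.1, hr.2.trans_lt ht.2⟩ ?_
        rw [abs_sub_comm, abs_of_nonneg (sub_nonneg.2 hr.2), abs_sub_comm s,
          abs_of_nonneg (sub_nonneg.2 hst)]
        linarith [hr.1]
      · rw [abs_of_nonneg (sub_nonneg.2 hst), dist_comm]
        refine (hξ n).dist_le v hv hεv t s ht.1.le hst (hs.2.le.trans (hTge n)) fun r hr => ?_
        refine havoid r ⟨ht.1.trans_le hr.1, hr.2.trans_lt hs.2⟩ ?_
        rw [abs_of_nonneg (sub_nonneg.2 hr.1), abs_of_nonneg (sub_nonneg.2 hst)]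
        linarith [hr.2]
    exact le_of_tendsto ((hφ s).dist (hφ t)) hev
  refine ⟨T₀, φ, ⟨⟨hT₀pos, ?_, ?_⟩, hLip.continuous.continuousOn, hφ0, hφT⟩, ?_⟩
  · exact hLip.locallyLipschitz.locallyLipschitzOn
  · intro v hv
    -- Only time `0` escapes the bound, which was proved at interior times.
    refine measure_mono_null (t := {0}) ?_ (by simp)
    rintro t ⟨ht, hlt, hnot⟩
    by_contra hne
    exact (hspeed v hv t ⟨lt_of_le_of_ne ht.1 (Ne.symm hne), ht.2⟩ hnot).not_gt hlt
  · rintro S hS ⟨η, hη⟩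
    have : S ∈ A := ⟨hη.isPiPath.pos.le, fun ε _ => hη.relaxedJoin ε⟩
    exact (csInf_le hAb this).not_gt hS

/-! ### Joining points through a hierarchy of scales -/

/-- At the scale `α ^ n`, any two points of the ball of radius `n` that are within this distance
are approached, up to `α ^ (n + 1)`, by one line of `N` with speed-limit at least `3 (4 α) ^ n`. -/
def LinkedAt {d : ℕ} (N : Set (Line d × ℝ)) (α : ℝ) (n : ℕ) : Prop :=
  ∀ x y : E d, ‖x‖ ≤ n → ‖y‖ ≤ n → dist x y ≤ α ^ n →
    ∃ p ∈ N, 3 * (4 * α) ^ n ≤ p.2 ∧ ∃ u ∈ p.1.points, ∃ w ∈ p.1.points,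
      dist x u ≤ α ^ (n + 1) ∧ dist y w ≤ α ^ (n + 1)

/-- After `k` refinements, `2 ^ k` gaps of size `α ^ (n + k)` remain and are crossed at speed `ε`. A
link at level `n` costs `(1 / 4) ^ n`, and `2 * (1 / 4) ^ n` solves the recursion `τ n = 2 * τ (n +
1) + (1 / 4) ^ n`. -/
theorem relaxedJoin_of_linkedAt {d : ℕ} {N : Set (Line d × ℝ)} {α ε : ℝ} {n₀ : ℕ} (hα : 0 < α)
    (hα1 : α ≤ 1) (hε : 0 < ε) (h : ∀ n, n₀ ≤ n → LinkedAt N α n) (k : ℕ) :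
    ∀ (n : ℕ), n₀ ≤ n → ∀ x y : E d, ‖x‖ ≤ n → ‖y‖ ≤ n → dist x y ≤ α ^ n →
      RelaxedJoin N ε (2 * (1 / 4) ^ n + 2 ^ k * α ^ (n + k) / ε) x y := by
  induction k with
  | zero =>
    intro n _ x y _ _ hxy
    refine relaxedJoin_of_dist_le (by positivity) (hxy.trans ?_)
    have : ε * (2 * (1 / 4) ^ n + 2 ^ 0 * α ^ (n + 0) / ε) = ε * (2 * (1 / 4) ^ n) + α ^ n := by
      field_simp
      simp
    rw [this]
    have : 0 < ε * (2 * (1 / 4) ^ n) := by positivity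
    linarith
  | succ k ih =>
    intro n hn x y hx hy hxy
    obtain ⟨p, hp, hv, u, hu, w, hw, hxu, hyw⟩ := h n hn x y hx hy hxy
    have hle : α ^ (n + 1) ≤ α ^ n := pow_le_pow_of_le_one hα.le hα1 (Nat.le_succ n)
    have hle1 : α ^ (n + 1) ≤ 1 := pow_le_one₀ hα.le hα1
    -- Linking points may leave the ball of radius `n`, but by at most `1`; this is why the radius
    -- in `LinkedAt` grows with the level.
    have hb : ∀ a b : E d, ‖a‖ ≤ n → dist a b ≤ α ^ (n + 1) → ‖b‖ ≤ ((n + 1 : ℕ) : ℝ) := by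
      intro a b ha hab
      rw [dist_comm, dist_eq_norm] at hab
      have : ‖b‖ ≤ ‖a‖ + ‖b - a‖ := by simpa using norm_add_le a (b - a)
      push_cast
      linarith
    have hna : ∀ a : E d, ‖a‖ ≤ n → ‖a‖ ≤ ((n + 1 : ℕ) : ℝ) := fun a ha => by
      push_cast; linarith
    have j1 := ih (n + 1) (by omega) x u (hna x hx) (hb x u hx hxu) hxu
    have j3 := ih (n + 1) (by omega) w y (hb y w hy hyw) (hna y hy) (by rwa [dist_comm])
    have j2 : RelaxedJoin N ε ((1 / 4) ^ n) u w := by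
      refine relaxedJoin_of_mem_points (by positivity) hp hu hw ?_
      have h1 : dist u w ≤ 3 * α ^ n := by
        have := dist_triangle4 u x y w
        rw [dist_comm u x] at this
        linarith
      refine h1.trans ?_
      calc 3 * α ^ n = 3 * (4 * α) ^ n * (1 / 4) ^ n := by
            rw [mul_assoc, ← mul_pow]; congr 2; ring
        _ ≤ p.2 * (1 / 4) ^ n := by gcongr
    have j := (j1.trans (by positivity) (by positivity) j2).trans (by positivity) (by positivity) j3
    convert j using 1
    have e : n + 1 + k = n + (k + 1) := by ring
    rw [e]
    ring

/-- Since `2 * α < 1`, enough refinements, depending on `ε`, bring the crossing time of the residual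
gaps below `1`, so the total is at most `3` for every `ε`. Distant points are joined along a
subdivided segment. -/
theorem exists_time_relaxedJoin_of_linkedAt {d : ℕ} {N : Set (Line d × ℝ)} {α : ℝ} {n₀ : ℕ}
    (hα : 0 < α) (hα1 : α ≤ 1 / 4) (h : ∀ n, n₀ ≤ n → LinkedAt N α n) (x y : E d) :
    ∃ T : ℝ, 0 ≤ T ∧ ∀ ε : ℝ, 0 < ε → RelaxedJoin N ε T x y := by
  obtain ⟨n, hn⟩ := exists_nat_ge (max (n₀ : ℝ) (max ‖x‖ ‖y‖))
  have hn0 : n₀ ≤ n := by exact_mod_cast (le_max_left _ _).trans hn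
  have hx : ‖x‖ ≤ n := ((le_max_left _ _).trans (le_max_right _ _)).trans hn
  have hy : ‖y‖ ≤ n := ((le_max_right _ _).trans (le_max_right _ _)).trans hn
  have short : ∀ a b : E d, ‖a‖ ≤ n → ‖b‖ ≤ n → dist a b ≤ α ^ n → ∀ ε : ℝ, 0 < ε →
      RelaxedJoin N ε 3 a b := by
    intro a b ha hb hab ε hε
    obtain ⟨k, hk⟩ := exists_pow_lt_of_lt_one hε (show 2 * α < 1 by linarith)
    refine (relaxedJoin_of_linkedAt hα (by linarith) hε h k n hn0 a b ha hb hab).mono_time hε.le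
      (by positivity) ?_
    have h1 : 2 ^ k * α ^ (n + k) / ε ≤ 1 := by
      rw [div_le_one hε, pow_add]
      have : α ^ n ≤ 1 := pow_le_one₀ hα.le (by linarith)
      calc 2 ^ k * (α ^ n * α ^ k) = α ^ n * (2 * α) ^ k := by rw [mul_pow]; ring
        _ ≤ 1 * (2 * α) ^ k := by gcongr
        _ ≤ ε := by rw [one_mul]; exact hk.le
    have h2 : (1 / 4 : ℝ) ^ n ≤ 1 := pow_le_one₀ (by norm_num) (by norm_num)
    linarith
  obtain ⟨L, hL⟩ := exists_nat_ge (dist x y / α ^ n)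
  have hL' : dist x y ≤ α ^ n * (L + 1 : ℝ) := by
    rw [div_le_iff₀ (by positivity)] at hL
    nlinarith [pow_pos hα n]
  have hball : ∀ s ∈ Icc (0 : ℝ) 1, ‖(AffineMap.lineMap x y s : E d)‖ ≤ n := by
    intro s hs
    have hc := (convex_closedBall (0 : E d) n).lineMap_mem (mem_closedBall_zero_iff.2 hx)
      (mem_closedBall_zero_iff.2 hy) hs
    exact mem_closedBall_zero_iff.1 hc
  have hLp : (0 : ℝ) < L + 1 := by positivity
  have chain : ∀ j : ℕ, j ≤ L + 1 → ∀ ε : ℝ, 0 < ε →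
      RelaxedJoin N ε (3 * j) x (AffineMap.lineMap x y ((j : ℝ) / (L + 1))) := by
    intro j
    induction j with
    | zero =>
      intro _ ε hε
      simpa using relaxedJoin_of_dist_le (N := N) (ε := ε) (T := 0) (x := x) (y := x) le_rfl
        (by simp)
    | succ j ih =>
      intro hj ε hε
      have hjL : (j : ℝ) + 1 ≤ L + 1 := by exact_mod_cast hj
      have hj0 : (0 : ℝ) ≤ j := Nat.cast_nonneg j
      have hs := short (AffineMap.lineMap x y ((j : ℝ) / (L + 1)))
        (AffineMap.lineMap x y (((j + 1 : ℕ) : ℝ) / (L + 1)))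
        (hball _ ⟨by positivity, by rw [div_le_one hLp]; linarith⟩)
        (hball _ ⟨by positivity, by rw [div_le_one hLp]; push_cast; linarith⟩)
        (by
          rw [dist_lineMap_lineMap, Real.dist_eq, ← sub_div, Nat.cast_succ, sub_add_cancel_left,
            neg_div, abs_neg, abs_of_pos (by positivity), div_mul_eq_mul_div, one_mul,
            div_le_iff₀ hLp]
          exact hL') ε hε
      have := (ih (by omega) ε hε).trans (by positivity) (by norm_num) hs
      convert this using 1
      push_cast
      ring
  refine ⟨3 * ((L + 1 : ℕ) : ℝ), by positivity, fun ε hε => ?_⟩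
  have := chain (L + 1) le_rfl ε hε
  rwa [Nat.cast_succ, div_self hLp.ne', AffineMap.lineMap_apply_one, ← Nat.cast_succ] at this

/-! ### Estimates for the intensity -/

/-- The lines that meet `U`. -/
def hitting {d : ℕ} (U : Set (E d)) : Set (Line d) := {l | (l.points ∩ U).Nonempty}

theorem mem_points_lineThrough {d : ℕ} {e : Metric.sphere (0 : E d) 1} {x z : E d} :
    z ∈ (lineThrough e x).points ↔ ∃ t : ℝ, x + t • (e : E d) = z := by
  change z ∈ AffineSubspace.mk' x (ℝ ∙ (e : E d)) ↔ _
  rw [AffineSubspace.mem_mk', vsub_eq_sub, Submodule.mem_span_singleton]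
  refine exists_congr fun t => ?_
  rw [eq_sub_iff_add_eq, add_comm]

theorem lineThrough_mem_hitting {d : ℕ} {e : Metric.sphere (0 : E d) 1} {x : E d}
    {U : Set (E d)} : lineThrough e x ∈ hitting U ↔ ∃ t : ℝ, x + t • (e : E d) ∈ U := by
  constructor
  · rintro ⟨z, hz, hzU⟩
    obtain ⟨t, rfl⟩ := mem_points_lineThrough.1 hz
    exact ⟨t, hzU⟩
  · rintro ⟨t, ht⟩
    exact ⟨_, mem_points_lineThrough.2 ⟨t, rfl⟩, ht⟩

theorem measurableSet_hitting {d : ℕ} {U : Set (E d)} (hU : IsOpen U) :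
    MeasurableSet (hitting U) := by
  change MeasurableSet ((fun p : Metric.sphere (0 : E d) 1 × E d => lineThrough p.1 p.2) ⁻¹'
    hitting U)
  have e : (fun p : Metric.sphere (0 : E d) 1 × E d => lineThrough p.1 p.2) ⁻¹' hitting U =
      ⋃ t : ℝ, (fun p : Metric.sphere (0 : E d) 1 × E d => p.2 + t • (p.1 : E d)) ⁻¹' U := by
    ext p
    simp [lineThrough_mem_hitting]
  rw [e]
  -- In the quotient `σ`-algebra it suffices that the preimage among pairs (direction, point) is
  -- open.
  exact (isOpen_iUnion fun t => hU.preimage (by fun_prop)).measurableSet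

theorem finrank_orthogonal_direction {d : ℕ} (hd : 2 ≤ d) (e : Metric.sphere (0 : E d) 1) :
    Module.finrank ℝ ((ℝ ∙ (e : E d))ᗮ : Submodule ℝ (E d)) = d - 1 := by
  have : Fact (Module.finrank ℝ (E d) = (d - 1) + 1) := ⟨by simp; omega⟩
  refine Submodule.finrank_orthogonal_span_singleton fun h => ?_
  have := e.2
  simp [h] at this

/-- The volume of the unit ball in dimension `k`. -/
def unitBallVolume (k : ℕ) : ℝ≥0∞ :=
  ENNReal.ofReal (√Real.pi ^ k / Real.Gamma (k / 2 + 1))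

theorem unitBallVolume_ne_zero (k : ℕ) : unitBallVolume k ≠ 0 := by
  have : 0 < √Real.pi ^ k / Real.Gamma (k / 2 + 1) :=
    div_pos (pow_pos (Real.sqrt_pos.2 Real.pi_pos) _) (Real.Gamma_pos_of_pos (by positivity))
  simpa [unitBallVolume] using this

theorem volume_ball_orthogonal {d : ℕ} (hd : 2 ≤ d) (e : Metric.sphere (0 : E d) 1)
    (z : ((ℝ ∙ (e : E d))ᗮ : Submodule ℝ (E d))) (r : ℝ) :
    volume (Metric.ball z r) = ENNReal.ofReal r ^ (d - 1) * unitBallVolume (d - 1) := by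
  have hf := finrank_orthogonal_direction hd e
  have : Nontrivial ((ℝ ∙ (e : E d))ᗮ : Submodule ℝ (E d)) :=
    Module.nontrivial_of_finrank_pos (R := ℝ) (by omega)
  rw [InnerProductSpace.volume_ball, hf, unitBallVolume]

theorem lineMeasure_normalization {d : ℕ} :
    (2 * volume (Metric.ball (0 : E (d - 1)) 1))⁻¹ ≠ 0 ∧
      (2 * volume (Metric.ball (0 : E (d - 1)) 1))⁻¹ ≠ ∞ := by
  constructor
  · rw [ENNReal.inv_ne_zero]
    exact ENNReal.mul_ne_top (by simp) measure_ball_lt_top.ne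
  · rw [ENNReal.inv_ne_top]
    exact mul_ne_zero (by simp) (Metric.measure_ball_pos _ _ one_pos).ne'

/-- By Pythagoras, the foot of a line that hits the ball lies in a `(d - 1)`-dimensional ball of the
same radius. -/
theorem exists_lineMeasure_hitting_ball_le {d : ℕ} (hd : 2 ≤ d) :
    ∃ C : ℝ≥0, ∀ R : ℝ, lineMeasure d (hitting (Metric.ball 0 R)) ≤
      C * ENNReal.ofReal R ^ (d - 1) := by
  set κ := (2 * volume (Metric.ball (0 : E (d - 1)) 1))⁻¹ with hκ
  set C : ℝ≥0∞ := κ * ((volume : Measure (E d)).toSphere univ * unitBallVolume (d - 1)) with hC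
  have hCtop : C ≠ ∞ := by
    refine ENNReal.mul_ne_top lineMeasure_normalization.2 (ENNReal.mul_ne_top ?_ ?_)
    · exact measure_ne_top _ _
    · exact ENNReal.ofReal_ne_top
  refine ⟨C.toNNReal, fun R => ?_⟩
  rw [ENNReal.coe_toNNReal hCtop, lineMeasure_apply d (measurableSet_hitting Metric.isOpen_ball)]
  have hle : ∀ e : Metric.sphere (0 : E d) 1,
      volume {y : ((ℝ ∙ (e : E d))ᗮ : Submodule ℝ (E d)) |
        lineThrough e (y : E d) ∈ hitting (Metric.ball 0 R)} ≤
      ENNReal.ofReal R ^ (d - 1) * unitBallVolume (d - 1) := by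
    intro e
    rw [← volume_ball_orthogonal hd e 0]
    refine measure_mono fun y hy => ?_
    obtain ⟨t, ht⟩ := lineThrough_mem_hitting.1 hy
    have hb : inner ℝ (y : E d) (t • (e : E d)) = 0 := by
      rw [inner_smul_right, real_inner_comm,
        Submodule.mem_orthogonal_singleton_iff_inner_right.mp y.2, mul_zero]
    rw [mem_ball_zero_iff] at ht ⊢
    refine lt_of_le_of_lt ?_ ht
    have := norm_add_sq_eq_norm_sq_add_norm_sq_of_inner_eq_zero _ _ hb
    rw [Submodule.coe_norm]
    refine le_of_sq_le_sq ?_ (norm_nonneg _)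
    nlinarith [mul_self_nonneg ‖t • (e : E d)‖]
  calc _ ≤ κ * ∫⁻ _e : Metric.sphere (0 : E d) 1,
        ENNReal.ofReal R ^ (d - 1) * unitBallVolume (d - 1) ∂(volume : Measure (E d)).toSphere := by
        gcongr with e; exact hle e
    _ = C * ENNReal.ofReal R ^ (d - 1) := by
        rw [lintegral_const, hC]; ring

theorem exists_unit_direction {d : ℕ} (hd : 2 ≤ d) (x y : E d) :
    ∃ u : Metric.sphere (0 : E d) 1, y = x + dist x y • (u : E d) := by
  rcases eq_or_ne x y with rfl | h
  · have : Nontrivial (E d) := Module.nontrivial_of_finrank_pos (R := ℝ) (by simp; omega)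
    obtain ⟨u, hu⟩ := exists_norm_eq (E d) zero_le_one
    exact ⟨⟨u, by simpa using hu⟩, by simp⟩
  · have h0 : ‖y - x‖ ≠ 0 := norm_ne_zero_iff.2 (sub_ne_zero.2 h.symm)
    refine ⟨⟨‖y - x‖⁻¹ • (y - x), by simp [norm_smul, h0]⟩, ?_⟩
    rw [dist_comm, dist_eq_norm, smul_smul, mul_inv_cancel₀ h0, one_smul, add_sub_cancel]

/-- Lines passing within `r / 2` of `x`, with direction in a fixed small cap about that from `x` to
`y`, hit both balls; the area of the cap is bounded below whatever its centre. -/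
theorem exists_le_lineMeasure_hitting_inter {d : ℕ} (hd : 2 ≤ d) {K : ℝ} (hK : 0 ≤ K) :
    ∃ c : ℝ≥0, c ≠ 0 ∧ ∀ (r : ℝ) (x y : E d), 0 < r → dist x y ≤ K * r →
      c * ENNReal.ofReal r ^ (d - 1) ≤
        lineMeasure d (hitting (Metric.ball x r) ∩ hitting (Metric.ball y r)) := by
  set κ := (2 * volume (Metric.ball (0 : E (d - 1)) 1))⁻¹ with hκ
  -- Tilting by `η` over a distance `K * r` displaces by at most `r / 2`.
  set η : ℝ := 1 / (2 * (K + 1)) with hη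
  have hη0 : 0 < η := by positivity
  have hKη : K * η ≤ 1 / 2 := by
    rw [hη, mul_one_div, div_le_div_iff₀ (by positivity) two_pos]; linarith
  set b : ℝ≥0∞ := Measure.toSphereBallBound (Module.finrank ℝ (E d)) η *
    volume (Metric.ball (0 : E d) 1) with hb
  have hb0 : b ≠ 0 := mul_ne_zero
    (by simpa using (Measure.toSphereBallBound_pos (Module.finrank ℝ (E d)) η).ne')
    (Metric.measure_ball_pos _ _ one_pos).ne'
  set C : ℝ≥0∞ := κ * (ENNReal.ofReal (1 / 2) ^ (d - 1) * unitBallVolume (d - 1) * b) with hC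
  have hhalf : ENNReal.ofReal (1 / 2) ≠ 0 := by simp
  have hC0 : C ≠ 0 := mul_ne_zero lineMeasure_normalization.1
    (mul_ne_zero (mul_ne_zero (pow_ne_zero _ hhalf) (unitBallVolume_ne_zero _)) hb0)
  have hCtop : C ≠ ∞ := by
    refine ENNReal.mul_ne_top lineMeasure_normalization.2
      (ENNReal.mul_ne_top (ENNReal.mul_ne_top ?_ ENNReal.ofReal_ne_top) ?_)
    · exact ENNReal.pow_ne_top ENNReal.ofReal_ne_top
    · exact ENNReal.mul_ne_top ENNReal.coe_ne_top measure_ball_lt_top.ne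
  refine ⟨C.toNNReal, (ENNReal.toNNReal_pos hC0 hCtop).ne', fun r x y hr hxy => ?_⟩
  rw [ENNReal.coe_toNNReal hCtop, lineMeasure_apply d
    ((measurableSet_hitting Metric.isOpen_ball).inter (measurableSet_hitting Metric.isOpen_ball))]
  obtain ⟨u, hu⟩ := exists_unit_direction hd x y
  set M : ℝ≥0∞ := ENNReal.ofReal (r / 2) ^ (d - 1) * unitBallVolume (d - 1) with hM
  have hle : ∀ e ∈ Metric.ball u η, M ≤
      volume {z : ((ℝ ∙ (e : E d))ᗮ : Submodule ℝ (E d)) |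
        lineThrough e (z : E d) ∈ hitting (Metric.ball x r) ∩ hitting (Metric.ball y r)} := by
    intro e he
    have he1 : ‖(e : E d)‖ = 1 := by simp
    have hmem : x - inner ℝ (e : E d) x • (e : E d) ∈ (ℝ ∙ (e : E d))ᗮ := by
      rw [Submodule.mem_orthogonal_singleton_iff_inner_right, inner_sub_right, inner_smul_right,
        real_inner_self_eq_norm_sq, he1]
      ring
    rw [hM, ← volume_ball_orthogonal hd e ⟨_, hmem⟩]
    refine measure_mono fun z hz => ?_
    rw [Metric.mem_ball, Subtype.dist_eq, dist_eq_norm] at hz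
    have heu : ‖(e : E d) - u‖ < η := by
      rw [Metric.mem_ball, Subtype.dist_eq, dist_eq_norm] at he
      exact he
    refine ⟨lineThrough_mem_hitting.2 ⟨inner ℝ (e : E d) x, ?_⟩,
      lineThrough_mem_hitting.2 ⟨inner ℝ (e : E d) x + dist x y, ?_⟩⟩
    · rw [Metric.mem_ball, dist_eq_norm]
      have : (z : E d) + inner ℝ (e : E d) x • (e : E d) - x =
        z - (x - inner ℝ (e : E d) x • (e : E d)) := by abel
      rw [this]
      linarith
    · rw [Metric.mem_ball, dist_eq_norm]
      have : (z : E d) + (inner ℝ (e : E d) x + dist x y) • (e : E d) - y =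
          (z - (x - inner ℝ (e : E d) x • (e : E d))) + dist x y • ((e : E d) - u) := by
        conv_lhs => rw [hu]
        rw [add_smul, smul_sub]
        have hdd : dist x (x + dist x y • (u : E d)) = dist x y := by rw [← hu]
        rw [hdd]
        abel
      rw [this]
      refine (norm_add_le _ _).trans_lt ?_
      rw [norm_smul, Real.norm_of_nonneg dist_nonneg]
      have h1 : dist x y * ‖(e : E d) - u‖ ≤ (K * r) * η := by gcongr
      nlinarith
  have hr2 : ENNReal.ofReal (r / 2) = ENNReal.ofReal (1 / 2) * ENNReal.ofReal r := by
    rw [← ENNReal.ofReal_mul (by norm_num)]; congr 1; ring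
  calc C * ENNReal.ofReal r ^ (d - 1) = κ * (M * b) := by
        rw [hC, hM, hr2, mul_pow]; ring
    _ ≤ κ * (M * (volume : Measure (E d)).toSphere (Metric.ball u η)) := by
        gcongr
        exact Measure.toSphereBallBound_mul_measure_unitBall_le_toSphere_ball volume hη0 u
    _ = κ * ∫⁻ e, (Metric.ball u η).indicator (fun _ => M) e
          ∂(volume : Measure (E d)).toSphere := by
        rw [lintegral_indicator_const Metric.isOpen_ball.measurableSet]
    _ ≤ _ := by
        gcongr with e
        by_cases he : e ∈ Metric.ball u η
        · rw [indicator_of_mem he]; exact hle e he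
        · rw [indicator_of_notMem he]; exact zero_le

theorem speedMeasure_Ici {γ v : ℝ} (hγ : 1 < γ) (hv : 0 < v) :
    ((volume.restrict (Ioi (0 : ℝ))).withDensity
      fun v => ENNReal.ofReal ((γ - 1) * v ^ (-γ))) (Ici v) = ENNReal.ofReal (v ^ (1 - γ)) := by
  rw [withDensity_apply _ measurableSet_Ici, Measure.restrict_restrict measurableSet_Ici,
    inter_eq_left.2 (Ici_subset_Ioi.2 hv), Measure.restrict_congr_set Ioi_ae_eq_Ici.symm,
    ← ofReal_integral_eq_lintegral_ofReal]
  · rw [integral_const_mul, integral_Ioi_rpow_of_lt (by linarith) hv]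
    congr 1
    have : γ - 1 ≠ 0 := by linarith
    have e : -γ + 1 = -(γ - 1) := by ring
    have e' : 1 - γ = -(γ - 1) := by ring
    rw [e, e']
    field_simp
  · exact (integrableOn_Ioi_rpow_of_lt (by linarith) hv).const_mul _
  · filter_upwards [ae_restrict_mem measurableSet_Ioi] with w hw
    exact mul_nonneg (by linarith) (Real.rpow_nonneg (hv.trans hw).le _)

theorem intensity_prod_Ici {d : ℕ} {γ v : ℝ} (hγ : 1 < γ) (hv : 0 < v) (A : Set (Line d)) :
    intensity d γ (A ×ˢ Ici v) = lineMeasure d A * ENNReal.ofReal (v ^ (1 - γ)) := by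
  rw [intensity, Measure.prod_prod, speedMeasure_Ici hγ hv]

/-! ### Almost sure properties of the Poisson process -/

/-! ### Void probabilities and finiteness of counts -/

section General

variable {Ω : Type*} [MeasurableSpace Ω] {P : Measure Ω} {X : Type*} [MeasurableSpace X]
  {Λ : Measure X} {N : Ω → Set X} {B : Set X}

theorem IsPoissonProcess.measure_void (hN : IsPoissonProcess P Λ N) (hB : MeasurableSet B)
    (hΛ : Λ B ≠ ∞) : P {ω | N ω ∩ B = ∅} = ENNReal.ofReal (Real.exp (-(Λ B).toReal)) := by
  have := hN.poisson_count B hB hΛ 0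
  rw [poissonMeasure_singleton] at this
  simpa [ENNReal.coe_toNNReal_eq_toReal] using this

theorem IsPoissonProcess.measure_nonempty_le [IsProbabilityMeasure P]
    (hN : IsPoissonProcess P Λ N) (hB : MeasurableSet B) (hΛ : Λ B ≠ ∞) :
    P {ω | (N ω ∩ B).Nonempty} ≤ Λ B := by
  have hm : MeasurableSet {ω | N ω ∩ B = ∅} := by
    simpa [preimage] using hN.measurable_count B hB (measurableSet_singleton (0 : ℕ∞))
  have e : {ω | (N ω ∩ B).Nonempty} = {ω | N ω ∩ B = ∅}ᶜ := by
    ext ω; simp [nonempty_iff_ne_empty]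
  rw [e, prob_compl_eq_one_sub hm, hN.measure_void hB hΛ, ← ENNReal.ofReal_one,
    ← ENNReal.ofReal_sub _ (Real.exp_pos _).le]
  conv_rhs => rw [← ENNReal.ofReal_toReal hΛ]
  refine ENNReal.ofReal_le_ofReal ?_
  linarith [Real.add_one_le_exp (-(Λ B).toReal)]

theorem IsPoissonProcess.ae_finite [IsProbabilityMeasure P]
    (hN : IsPoissonProcess P Λ N) (hB : MeasurableSet B) (hΛ : Λ B ≠ ∞) :
    ∀ᵐ ω ∂P, (N ω ∩ B).Finite := by
  have hm : ∀ k : ℕ, MeasurableSet {ω | (N ω ∩ B).encard = k} := fun k =>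
    hN.measurable_count B hB (measurableSet_singleton (k : ℕ∞))
  have hdisj : Pairwise (Function.onFun Disjoint fun k : ℕ => {ω | (N ω ∩ B).encard = k}) := by
    intro i j hij
    refine Set.disjoint_left.2 fun ω hi hj => hij ?_
    have : (i : ℕ∞) = j := hi.symm.trans hj
    exact_mod_cast this
  have hone : P (⋃ k : ℕ, {ω | (N ω ∩ B).encard = k}) = 1 := by
    rw [measure_iUnion hdisj hm]
    simp_rw [hN.poisson_count B hB hΛ]
    rw [← measure_iUnion (fun i j hij => by simpa using hij) fun _ => measurableSet_singleton _]
    have : (⋃ i : ℕ, ({i} : Set ℕ)) = univ := by ext; simp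
    rw [this, measure_univ]
  have hae := (prob_compl_eq_zero_iff (MeasurableSet.iUnion hm)).2 hone
  filter_upwards [measure_eq_zero_iff_ae_notMem.1 hae] with ω hω
  rw [notMem_compl_iff, mem_iUnion] at hω
  obtain ⟨k, hk⟩ := hω
  exact finite_of_encard_eq_coe hk

end General

variable {Ω : Type*} [MeasurableSpace Ω] {P : Measure Ω} {d : ℕ} {γ : ℝ}
  {N : Ω → Set (Line d × ℝ)}

theorem intensity_hitting_ball_ne_top (hd : 2 ≤ d) (hγ : 1 < γ) {v : ℝ} (hv : 0 < v) (R : ℝ) :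
    intensity d γ (hitting (Metric.ball 0 R) ×ˢ Ici v) ≠ ∞ := by
  obtain ⟨C, hC⟩ := exists_lineMeasure_hitting_ball_le hd
  rw [intensity_prod_Ici hγ hv]
  refine ENNReal.mul_ne_top (ne_top_of_le_ne_top ?_ (hC R)) ENNReal.ofReal_ne_top
  exact ENNReal.mul_ne_top ENNReal.coe_ne_top (ENNReal.pow_ne_top ENNReal.ofReal_ne_top)

theorem measurableSet_hitting_ball_prod (x : E d) (R v : ℝ) :
    MeasurableSet (hitting (Metric.ball x R) ×ˢ Ici v) :=
  (measurableSet_hitting Metric.isOpen_ball).prod measurableSet_Ici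

theorem ae_finite_fastLines [IsProbabilityMeasure P] (hd : 2 ≤ d) (hγ : 1 < γ)
    (hN : IsPoissonProcess P (intensity d γ) N) :
    ∀ᵐ ω ∂P, ∀ v : ℝ, 0 < v → ∀ R : ℝ, (fastLines (N ω) v R).Finite := by
  have h : ∀ᵐ ω ∂P, ∀ n : ℕ,
      (N ω ∩ hitting (Metric.ball (0 : E d) (n + 1)) ×ˢ Ici (1 / ((n : ℝ) + 1))).Finite :=
    ae_all_iff.2 fun n => hN.ae_finite (measurableSet_hitting_ball_prod _ _ _)
      (intensity_hitting_ball_ne_top hd hγ Nat.one_div_pos_of_nat _)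
  filter_upwards [h] with ω hω v hv R
  obtain ⟨n, hn⟩ := exists_nat_ge (max R (1 / v))
  have hnR : R < n + 1 := by linarith [le_max_left R (1 / v)]
  have hnv : 1 / ((n : ℝ) + 1) ≤ v := by
    have : 1 / v ≤ n + 1 := by linarith [le_max_right R (1 / v)]
    rwa [one_div_le (by positivity) hv]
  refine (hω n).subset ?_
  rintro p ⟨hp, hpv, z, hz, hzR⟩
  exact ⟨hp, ⟨z, hz, Metric.closedBall_subset_ball hnR hzR⟩, hnv.trans hpv⟩

/-- The expected number of lines of speed of order `R` meeting a ball of radius of order `R` is `O(R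
^ (d - γ))`. One good `R` suffices, so no independence or summability is needed. -/
theorem ae_exists_slowIn [IsProbabilityMeasure P] (hd : 2 ≤ d) (hγ : (d : ℝ) < γ)
    (hN : IsPoissonProcess P (intensity d γ) N) (x : E d) :
    ∀ᵐ ω ∂P, ∀ T : ℝ, 0 ≤ T → ∃ V R : ℝ, 0 < V ∧ ‖x‖ + V * T < R ∧ SlowIn (N ω) V R := by
  have hd' : (2 : ℝ) ≤ d := by exact_mod_cast hd
  have hγ1 : 1 < γ := by linarith
  obtain ⟨C, hC⟩ := exists_lineMeasure_hitting_ball_le hd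
  have h : ∀ᵐ ω ∂P, ∀ M : ℕ, ∃ R : ℝ, 0 < R ∧ 2 * ‖x‖ ≤ R ∧
      N ω ∩ hitting (Metric.ball (0 : E d) (2 * R)) ×ˢ Ici (R / (2 * (M + 1))) = ∅ := by
    refine ae_all_iff.2 fun M => ?_
    set B : ℝ → Set (Line d × ℝ) := fun R =>
      hitting (Metric.ball (0 : E d) (2 * R)) ×ˢ Ici (R / (2 * (M + 1))) with hB
    set a : ℝ := 2 ^ (d - 1) * (1 / (2 * ((M : ℝ) + 1))) ^ (1 - γ) with ha
    have hbound : ∀ R, 0 < R → intensity d γ (B R) ≤ C * ENNReal.ofReal (a * R ^ (-(γ - d))) := by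
      intro R hR
      have hv : 0 < R / (2 * ((M : ℝ) + 1)) := by positivity
      rw [hB, intensity_prod_Ici hγ1 hv]
      calc _ ≤ C * ENNReal.ofReal (2 * R) ^ (d - 1) *
            ENNReal.ofReal ((R / (2 * ((M : ℝ) + 1))) ^ (1 - γ)) := by
            gcongr; exact hC _
        _ = C * ENNReal.ofReal (a * R ^ (-(γ - d))) := by
            rw [mul_assoc, ← ENNReal.ofReal_pow (by positivity),
              ← ENNReal.ofReal_mul (by positivity)]
            congr 2
            have e1 : R ^ (-(γ - d)) = R ^ (d - 1) * R ^ (1 - γ) := by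
              rw [← Real.rpow_natCast R (d - 1), ← Real.rpow_add hR]
              congr 1
              rw [Nat.cast_sub (by omega)]
              push_cast
              ring
            rw [div_eq_mul_one_div R, Real.mul_rpow hR.le (by positivity), mul_pow, ha, e1]
            ring
    have htend : Tendsto (fun R : ℝ => C * ENNReal.ofReal (a * R ^ (-(γ - d)))) atTop (𝓝 0) := by
      have h1 : Tendsto (fun R : ℝ => a * R ^ (-(γ - d))) atTop (𝓝 0) := by
        simpa using (tendsto_rpow_neg_atTop (show 0 < γ - d by linarith)).const_mul a
      have h2 := (ENNReal.tendsto_ofReal h1)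
      rw [ENNReal.ofReal_zero] at h2
      simpa using ENNReal.Tendsto.const_mul h2 (Or.inr (ENNReal.coe_ne_top (r := C)))
    rw [ae_iff]
    -- Failure for every radius is contained in the failure at each large `R`, whose probability
    -- tends to `0`.
    refine le_antisymm (ge_of_tendsto htend ?_) zero_le
    filter_upwards [eventually_gt_atTop 0, eventually_ge_atTop (2 * ‖x‖)] with R hR hRx
    refine le_trans ?_ ((hN.measure_nonempty_le (measurableSet_hitting_ball_prod _ _ _)
      (intensity_hitting_ball_ne_top hd hγ1 (by positivity) _)).trans (hbound R hR))
    refine measure_mono fun ω hω => ?_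
    by_contra hcon
    exact hω ⟨R, hR, hRx, Set.not_nonempty_iff_eq_empty.1 hcon⟩
  filter_upwards [h] with ω hω T hT
  obtain ⟨M, hM⟩ := exists_nat_ge T
  obtain ⟨R, hR, hRx, hvoid⟩ := hω M
  have hM0 : (0 : ℝ) ≤ M := Nat.cast_nonneg M
  refine ⟨R / (2 * (M + 1)), R, by positivity, ?_, ?_⟩
  · have : R / (2 * (M + 1)) * T < R / 2 := by
      rw [div_mul_eq_mul_div, div_lt_div_iff₀ (by positivity) two_pos]
      nlinarith
    linarith
  · refine Set.disjoint_left.2 fun z hz hzR => ?_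
    obtain ⟨p, ⟨hp, hpV⟩, hzp⟩ := mem_iUnion₂.1 hz
    have : p ∈ N ω ∩ hitting (Metric.ball (0 : E d) (2 * R)) ×ˢ Ici (R / (2 * (M + 1))) :=
      ⟨hp, ⟨z, hzp, Metric.closedBall_subset_ball (by linarith) hzR⟩, hpV⟩
    rw [hvoid] at this
    exact this

/-! ### Links at all small scales: lattice approximation and Borel–Cantelli -/

/-- The point of the lattice of mesh `δ` with coordinates `k`. -/
def gridPoint (δ : ℝ) (k : Fin d → ℤ) : E d := WithLp.toLp 2 fun i => δ * k i

theorem exists_gridPoint_dist_lt {δ r : ℝ} (hδ : 0 < δ) (hr : d * δ < r) {K : ℕ} {x : E d}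
    (hx : ‖x‖ ≤ δ * K) :
    ∃ k ∈ Fintype.piFinset fun _ : Fin d => Finset.Icc (-(K : ℤ)) K,
      dist x (gridPoint δ k) < r := by
  refine ⟨fun i => ⌊x i / δ⌋, ?_, lt_of_le_of_lt ?_ hr⟩
  · rw [Fintype.mem_piFinset]
    intro i
    have h1 : |x i| ≤ δ * K := (PiLp.norm_apply_le x i).trans hx
    rw [abs_le] at h1
    rw [Finset.mem_Icc]
    constructor
    · rw [Int.le_floor, le_div_iff₀ hδ]
      push_cast
      linarith
    · have : ((⌊x i / δ⌋ : ℤ) : ℝ) ≤ (K : ℤ) :=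
        (Int.floor_le _).trans ((div_le_iff₀ hδ).2 (by push_cast; linarith))
      exact_mod_cast this
  · rw [EuclideanSpace.dist_eq]
    refine Real.sqrt_le_iff.2 ⟨by positivity, ?_⟩
    have h1 : ∀ i, dist (x i) (gridPoint δ (fun i => ⌊x i / δ⌋) i) ^ 2 ≤ δ ^ 2 := by
      intro i
      have e : dist (x i) (gridPoint δ (fun i => ⌊x i / δ⌋) i) = |x i - δ * ⌊x i / δ⌋| := rfl
      rw [e, sq_abs]
      have h2 := Int.floor_le (x i / δ)
      have h3 := Int.lt_floor_add_one (x i / δ)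
      rw [le_div_iff₀ hδ] at h2
      rw [div_lt_iff₀ hδ] at h3
      nlinarith
    calc _ ≤ ∑ _i : Fin d, δ ^ 2 := Finset.sum_le_sum fun i _ => h1 i
      _ = d * δ ^ 2 := by simp
      _ ≤ (d * δ) ^ 2 := by
        rw [mul_pow]
        have : (d : ℝ) ≤ (d : ℝ) ^ 2 := by exact_mod_cast Nat.le_self_pow two_ne_zero d
        gcongr

/-- The product is `m ^ (γ - d) / 4 ^ (γ - 1)`, unbounded in `m`. It is the growth rate per level of
the lower bound for the mean number of linking lines; an integral `1 / α` lets the lattice meshes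
divide `1`. -/
theorem exists_ratio (hd : 1 ≤ d) (hγ : (d : ℝ) < γ) :
    ∃ m : ℕ, 4 ≤ m ∧ 1 < ((m : ℝ)⁻¹) ^ (d - 1) * (4 * (m : ℝ)⁻¹) ^ (1 - γ) := by
  have ht := (tendsto_rpow_atTop (show 0 < γ - d by linarith)).comp
    (tendsto_natCast_atTop_atTop (R := ℝ))
  obtain ⟨m, hm4, hm⟩ := ((eventually_ge_atTop 4).and
    (ht.eventually (eventually_gt_atTop ((4 : ℝ) ^ (γ - 1))))).exists
  refine ⟨m, hm4, ?_⟩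
  have hm0 : (0 : ℝ) < m := by exact_mod_cast (by omega : 0 < m)
  have e : ((m : ℝ)⁻¹) ^ (d - 1) * (4 * (m : ℝ)⁻¹) ^ (1 - γ) =
      (m : ℝ) ^ (γ - d) / 4 ^ (γ - 1) := by
    rw [Real.mul_rpow (by norm_num) (by positivity), ← Real.rpow_natCast, mul_left_comm,
      ← Real.rpow_add (by positivity), Real.inv_rpow hm0.le, ← Real.rpow_neg hm0.le,
      div_eq_mul_inv, ← Real.rpow_neg (by norm_num), mul_comm, Nat.cast_sub hd]
    congr 2 <;> push_cast <;> ring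
  rw [e, one_lt_div (by positivity)]
  exact hm

/-- Bounding `exp (-z)` by `k! / z ^ k` with `q < β ^ k` leaves a geometric series. -/
theorem summable_pow_mul_exp_neg {A q c β : ℝ} (hA : 0 ≤ A) (hq : 0 ≤ q) (hc : 0 < c)
    (hβ : 1 < β) : Summable fun n : ℕ => A * q ^ n * Real.exp (-(c * β ^ n)) := by
  obtain ⟨k, hk⟩ := pow_unbounded_of_one_lt q hβ
  have hβ0 : 0 < β := by linarith
  have hs : Summable fun n : ℕ => (A * k.factorial / c ^ k) * (q / β ^ k) ^ n :=
    (summable_geometric_of_lt_one (by positivity)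
      ((div_lt_one (by positivity)).2 hk)).mul_left _
  refine Summable.of_nonneg_of_le (fun n => by positivity) (fun n => ?_) hs
  have hz : 0 < c * β ^ n := by positivity
  have h1 := Real.pow_div_factorial_le_exp (c * β ^ n) hz.le k
  have h2 : Real.exp (-(c * β ^ n)) ≤ k.factorial / (c * β ^ n) ^ k := by
    rw [Real.exp_neg, ← inv_div]
    exact inv_anti₀ (by positivity) h1
  calc A * q ^ n * Real.exp (-(c * β ^ n)) ≤ A * q ^ n * (k.factorial / (c * β ^ n) ^ k) := by
        gcongr
    _ = (A * k.factorial / c ^ k) * (q / β ^ k) ^ n := by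
        rw [mul_pow, ← pow_mul, mul_comm n k, pow_mul, div_pow]
        field_simp

/-- At level `n` there are only exponentially many pairs of lattice points, while a given nearby
pair lacks a link with probability at most `exp (-(c₁ * β ^ n))`, `β > 1`. The union bound is
summable. -/
theorem ae_eventually_linkedAt (hd : 2 ≤ d) (hγ : (d : ℝ) < γ)
    (hN : IsPoissonProcess P (intensity d γ) N) :
    ∃ α : ℝ, 0 < α ∧ α ≤ 1 / 4 ∧ ∀ᵐ ω ∂P, ∃ n₀, ∀ n, n₀ ≤ n → LinkedAt (N ω) α n := by
  have hd' : (2 : ℝ) ≤ d := by exact_mod_cast hd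
  have hγ1 : 1 < γ := by linarith
  obtain ⟨m, hm4, hβ⟩ := exists_ratio (by omega) hγ
  have hm0 : (0 : ℝ) < m := by exact_mod_cast (by omega : 0 < m)
  have hm4' : (4 : ℝ) ≤ m := by exact_mod_cast hm4
  set α : ℝ := (m : ℝ)⁻¹ with hα
  have hα0 : 0 < α := inv_pos.2 hm0
  have hα4 : α ≤ 1 / 4 := by rw [hα, one_div]; exact inv_anti₀ (by norm_num) hm4'
  have hmα : m * α = 1 := mul_inv_cancel₀ hm0.ne'
  set β : ℝ := α ^ (d - 1) * (4 * α) ^ (1 - γ) with hβd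
  refine ⟨α, hα0, hα4, ?_⟩
  -- Lattice points near `x` and `y` are within `2 * α ^ n`, which is `4 * m` times the radius `α ^
  -- (n + 1) / 2`.
  obtain ⟨c, hc0, hc⟩ := exists_le_lineMeasure_hitting_inter hd (show 0 ≤ 4 * (m : ℝ) by positivity)
  have hcpos : 0 < c := pos_iff_ne_zero.2 hc0
  -- One radius is spent from the point to the lattice, the other from the lattice to the line.
  set r : ℕ → ℝ := fun n => α ^ (n + 1) / 2 with hr
  have hr0 : ∀ n, 0 < r n := fun n => by positivity
  set δ : ℕ → ℝ := fun n => r n / (d + 1) with hδ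
  have hδ0 : ∀ n, 0 < δ n := fun n => by positivity
  set K : ℕ → ℕ := fun n => n * (2 * (d + 1) * m ^ (n + 1)) with hK
  have hδK : ∀ n, δ n * K n = n := fun n => by
    have hp : α ^ (n + 1) * (m : ℝ) ^ (n + 1) = 1 := by
      rw [← mul_pow, mul_comm, hmα, one_pow]
    simp only [hδ, hr, hK]
    push_cast
    have : (d : ℝ) + 1 ≠ 0 := by positivity
    field_simp
    linear_combination (n : ℝ) * hp
  set I : ℕ → Finset (Fin d → ℤ) := fun n =>
    Fintype.piFinset fun _ : Fin d => Finset.Icc (-(K n : ℤ)) (K n) with hI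
  set B : ℕ → (Fin d → ℤ) × (Fin d → ℤ) → Set (Line d × ℝ) := fun n k =>
    (hitting (Metric.ball (gridPoint (δ n) k.1) (r n)) ∩
      hitting (Metric.ball (gridPoint (δ n) k.2) (r n))) ×ˢ Ici (3 * (4 * α) ^ n) with hB
  set c₁ : ℝ := c * ((α / 2) ^ (d - 1) * 3 ^ (1 - γ)) with hc₁
  have hc₁0 : 0 < c₁ := by
    have : (0 : ℝ) < c := by exact_mod_cast hcpos
    positivity
  have hvoid : ∀ n k, dist (gridPoint (d := d) (δ n) k.1) (gridPoint (δ n) k.2) ≤ 4 * m * r n →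
      P {ω | N ω ∩ B n k = ∅} ≤ ENNReal.ofReal (Real.exp (-(c₁ * β ^ n))) := by
    intro n k hk
    have hv : 0 < 3 * (4 * α) ^ n := by positivity
    have hmeas : MeasurableSet (B n k) := ((measurableSet_hitting Metric.isOpen_ball).inter
      (measurableSet_hitting Metric.isOpen_ball)).prod measurableSet_Ici
    have hlow : ENNReal.ofReal (c₁ * β ^ n) ≤ intensity d γ (B n k) := by
      rw [hB, intensity_prod_Ici hγ1 hv]
      refine le_trans (le_of_eq ?_) (mul_le_mul_left (hc (r n) _ _ (hr0 n) hk) _)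
      rw [← ENNReal.ofReal_coe_nnreal, ← ENNReal.ofReal_pow (hr0 n).le,
        ← ENNReal.ofReal_mul (by positivity), ← ENNReal.ofReal_mul (by
          have := hr0 n; positivity)]
      congr 1
      have e1 : (3 * (4 * α) ^ n) ^ (1 - γ) = 3 ^ (1 - γ) * ((4 * α) ^ (1 - γ)) ^ n := by
        rw [Real.mul_rpow (by norm_num) (by positivity), ← Real.rpow_natCast (4 * α) n,
          ← Real.rpow_mul (by positivity), ← Real.rpow_natCast ((4 * α) ^ (1 - γ)) n,
          ← Real.rpow_mul (by positivity), mul_comm (n : ℝ)]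
      have e2 : r n ^ (d - 1) = (α / 2) ^ (d - 1) * (α ^ (d - 1)) ^ n := by
        simp only [hr]
        rw [← pow_mul, mul_comm (d - 1) n, pow_mul, ← mul_pow]
        congr 1
        ring
      rw [e1, e2, hc₁, hβd, mul_pow]
      ring
    have hfin : intensity d γ (B n k) ≠ ∞ := by
      set R := ‖gridPoint (d := d) (δ n) k.1‖ + r n
      refine ne_top_of_le_ne_top (intensity_hitting_ball_ne_top hd hγ1 hv R)
        (measure_mono (prod_mono ?_ subset_rfl))
      rintro l ⟨⟨z, hzl, hz⟩, -⟩
      refine ⟨z, hzl, Metric.ball_subset_ball' ?_ hz⟩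
      rw [dist_zero_right]
      exact (add_comm _ _).le
    rw [hN.measure_void hmeas hfin]
    refine ENNReal.ofReal_le_ofReal (Real.exp_le_exp.2 (neg_le_neg ?_))
    rw [← ENNReal.ofReal_le_iff_le_toReal hfin]
    exact hlow
  set J : ℕ → Finset ((Fin d → ℤ) × (Fin d → ℤ)) := fun n => {k ∈ I n ×ˢ I n |
    dist (gridPoint (d := d) (δ n) k.1) (gridPoint (δ n) k.2) ≤ 4 * m * r n} with hJ
  set bad : ℕ → Set Ω := fun n => ⋃ k ∈ J n, {ω | N ω ∩ B n k = ∅} with hbad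
  set A : ℝ := 4 * (d + 1) * m + 1 with hA
  have hcard : ∀ n, ((J n).card : ℝ) ≤ A ^ (2 * d) * ((2 * m : ℝ) ^ (2 * d)) ^ n := by
    intro n
    have h1 : (J n).card ≤ (2 * K n + 1) ^ (2 * d) := by
      refine (Finset.card_filter_le _ _).trans (le_of_eq ?_)
      rw [Finset.card_product, Fintype.card_piFinset_const, Int.card_Icc, ← pow_add, ← two_mul]
      congr 1
      omega
    have h2 : ((2 * K n + 1 : ℕ) : ℝ) ≤ A * (2 * m) ^ n := by
      have hn : (n : ℝ) ≤ 2 ^ n := by exact_mod_cast Nat.lt_two_pow_self.le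
      have hone : (1 : ℝ) ≤ (2 * m) ^ n := one_le_pow₀ (by linarith)
      have h3 : (n : ℝ) * m ^ n ≤ (2 * m) ^ n := by rw [mul_pow]; gcongr
      have h4 : (0 : ℝ) ≤ 4 * (d + 1) * m := by positivity
      simp only [hK, hA]
      push_cast
      calc (2 * (n * (2 * ((d : ℝ) + 1) * m ^ (n + 1))) + 1 : ℝ)
          = 4 * (d + 1) * m * (n * m ^ n) + 1 := by ring
        _ ≤ 4 * (d + 1) * m * (2 * m) ^ n + (2 * m) ^ n := by gcongr
        _ = (4 * (d + 1) * m + 1) * (2 * m) ^ n := by ring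
    calc ((J n).card : ℝ) ≤ ((2 * K n + 1 : ℕ) : ℝ) ^ (2 * d) := by exact_mod_cast h1
      _ ≤ (A * (2 * m) ^ n) ^ (2 * d) := by gcongr
      _ = A ^ (2 * d) * ((2 * m : ℝ) ^ (2 * d)) ^ n := by
        rw [mul_pow, ← pow_mul, ← pow_mul, mul_comm n]
  have hbadle : ∀ n, P (bad n) ≤ ENNReal.ofReal
      (A ^ (2 * d) * ((2 * m : ℝ) ^ (2 * d)) ^ n * Real.exp (-(c₁ * β ^ n))) := by
    intro n
    calc P (bad n) ≤ ∑ k ∈ J n, P {ω | N ω ∩ B n k = ∅} := measure_biUnion_finset_le _ _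
      _ ≤ ∑ _k ∈ J n, ENNReal.ofReal (Real.exp (-(c₁ * β ^ n))) :=
        Finset.sum_le_sum fun k hk => hvoid n k (Finset.mem_filter.1 hk).2
      _ = ENNReal.ofReal ((J n).card * Real.exp (-(c₁ * β ^ n))) := by
        rw [Finset.sum_const, nsmul_eq_mul, ENNReal.ofReal_mul (by positivity),
          ENNReal.ofReal_natCast]
      _ ≤ _ := by
        refine ENNReal.ofReal_le_ofReal ?_
        gcongr
        exact hcard n
  have hsum : ∑' n, P (bad n) ≠ ∞ := by
    refine ne_top_of_le_ne_top ?_ (ENNReal.tsum_le_tsum hbadle)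
    exact (summable_pow_mul_exp_neg (by positivity) (by positivity) hc₁0 hβ).tsum_ofReal_ne_top
  filter_upwards [ae_eventually_notMem hsum] with ω hω
  obtain ⟨n₀, hn₀⟩ := eventually_atTop.1 hω
  refine ⟨n₀, fun n hn x y hx hy hxy => ?_⟩
  have hgood := hn₀ n hn
  have hdδ : d * δ n < r n := by
    simp only [hδ]
    rw [← mul_div_assoc, div_lt_iff₀ (by positivity)]
    nlinarith [hr0 n]
  obtain ⟨k, hkI, hk⟩ := exists_gridPoint_dist_lt (hδ0 n) hdδ (x := x) (K := K n) (by rwa [hδK n])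
  obtain ⟨l, hlI, hl⟩ := exists_gridPoint_dist_lt (hδ0 n) hdδ (x := y) (K := K n) (by rwa [hδK n])
  have hrn : 2 * r n = α ^ (n + 1) := by simp only [hr]; ring
  have hmr : 4 * m * r n = 2 * α ^ n := by
    simp only [hr]; linear_combination 2 * α ^ n * hmα
  have hle : α ^ (n + 1) ≤ α ^ n := pow_le_pow_of_le_one hα0.le (by linarith) (Nat.le_succ n)
  have hkl : (k, l) ∈ J n := by
    refine Finset.mem_filter.2 ⟨Finset.mem_product.2 ⟨hkI, hlI⟩, ?_⟩
    have := dist_triangle4 (gridPoint (δ n) k) x y (gridPoint (δ n) l)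
    rw [dist_comm _ x] at this
    rw [hmr]
    linarith
  have hne : (N ω ∩ B n (k, l)).Nonempty := by
    by_contra hcon
    exact hgood (mem_iUnion₂.2 ⟨(k, l), hkl, Set.not_nonempty_iff_eq_empty.1 hcon⟩)
  obtain ⟨p, hpN, ⟨⟨u, hu, huk⟩, w, hw, hwl⟩, hpv⟩ := hne
  rw [Metric.mem_ball, dist_comm] at huk hwl
  refine ⟨p, hpN, hpv, u, hu, w, hw, ?_, ?_⟩
  · linarith [dist_triangle x (gridPoint (δ n) k) u]
  · linarith [dist_triangle y (gridPoint (δ n) l) w]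

end PoissonRoads

end

/-- Almost sure existence of `Π`-geodesics between two fixed points, for the improper Poisson line
process in `ℝ^d` with speed-limit exponent `γ > d`. -/
theorem mainTheorem6 (d : ℕ) (hd : 2 ≤ d) (γ : ℝ) (hγ : (d : ℝ) < γ)
    {Ω : Type*} [MeasurableSpace Ω] (P : Measure Ω) [IsProbabilityMeasure P]
    (N : Ω → Set (PoissonRoads.Line d × ℝ))
    (hN : PoissonRoads.IsPoissonProcess P (PoissonRoads.intensity d γ) N)
    (x₁ x₂ : PoissonRoads.E d) (hx : x₁ ≠ x₂) :
    ∀ᵐ ω ∂P, ∃ (T : ℝ) (ξ : ℝ → PoissonRoads.E d),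
      PoissonRoads.IsPiGeodesic (N ω) T ξ x₁ x₂ := by
  have hγ1 : 1 < γ := by
    have : (2 : ℝ) ≤ d := by exact_mod_cast hd
    linarith
  obtain ⟨α, hα, hα4, hlink⟩ := PoissonRoads.ae_eventually_linkedAt hd hγ hN
  filter_upwards [PoissonRoads.ae_finite_fastLines hd hγ1 hN,
    PoissonRoads.ae_exists_slowIn hd hγ hN x₁, hlink] with ω hfin hslow ⟨n₀, hn₀⟩
  exact PoissonRoads.exists_isPiGeodesic hx hfin hslow
    (PoissonRoads.exists_time_relaxedJoin_of_linkedAt hα hα4 hn₀ x₁ x₂)
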